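/- Let $X$ be an infinite-dimensional complex Banach space, $L$ a complex nilpotent Lie algebra of finite dimension $n$, and $\rho\colon L\to L(X)$ a representation of $L$ by bounded linear operators on $X$ (a homomorphism of Lie algebras for the commutator bracket) such that $\rho(l)$ is compact for every $l\in L$. A character of $L$ is a linear form $f\in L^*$ with $f([a,b])=0$ for all $a,b\in L$. For a character $f$ let $d_p(\rho-f)\colon X\otimes\wedge^pL\to X\otimes\wedge^{p-1}L$ be the Koszul differential of the representation $\rho-f\cdot I$, where, for a representation $\theta$ of $L$ on $X$, $$d_p(\theta)(x\otimes l_1\wedge\dots\wedge l_p)=\sum_{k=1}^p(-1)^{k+1}\theta(l_k)x\otimes l_1\wedge\dots\wedge\hat{l_k}\wedge\dots\wedge l_p+\sum_{1\le i<j\le p}(-1)^{i+j-1}x\otimes[l_i,l_j]\wedge l_1\wedge\dots\wedge\hat{l_i}\wedge\dots\wedge\hat{l_j}\wedge\dots\wedge l_p$$ for $p\ge1$, and $d_0(\theta)=0$. Let $H_p(\rho-f)=\ker d_p(\rho-f)/\operatorname{im}d_{p+1}(\rho-f)$ and $$\sigma_p(\rho)=\{f\text{ a character of }L: H_p(\rho-f)\ne0\}.$$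 Let $\sigma(\rho)=\bigcup_{p=0}^n\sigma_p(\rho)$ be the Taylor joint spectrum and, for $0\le k\le n$, let $$\sigma_{\delta,k}(\rho)=\bigcup_{p=0}^k\sigma_p(\rho),\qquad \sigma_{\pi,k}(\rho)=\bigcup_{p=n-k}^n\sigma_p(\rho)\cup\{f\text{ a character of }L:\text{ the range of }d_{n-k}(\rho-f)\text{ is not closed}\}$$ be the Słodkowski joint spectra; here $X\otimes\wedge^pL\cong X^{\binom np}$ carries its usual Banach space topology. Then $\sigma(\rho)$ and, for every $k=0,\dots,n$, the sets $\sigma_{\delta,k}(\rho)\cup\{0\}$ and $\sigma_{\pi,k}(\rho)\cup\{0\}$ are all equal to $$\{0\}\cup\{f\text{ a character of }L:\text{ there is }x\in X,\ x\ne0,\text{ with }\rho(l)x=f(l)x\text{ for all }l\in L\}.$$ -/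

import Mathlib

open scoped TensorProduct Topology

-- The commutator bracket on an associative ring, here on `X →L[ℂ] X`.
attribute [local instance] LieRing.ofAssociativeRing

noncomputable section

namespace LieKoszul

universe u v

/-- The bracket part `⋀^(p+1) L → ⋀^p L` of the Koszul differential:
`l₀ ∧ ⋯ ∧ l_p ↦ ∑_{i<j} (-1)^(i+j+1) [l_i, l_j] ∧ l₀ ∧ ⋯ l̂_i ⋯ l̂_j ⋯ ∧ l_p` (indices from `0`).
Alternatization runs over all ordered pairs `i ≠ j`, hence the factor `1/2`;
see `bracketPart_ιMulti` for the formula. -/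
def bracketPart (L : Type v) [LieRing L] [LieAlgebra ℂ L] :
    ∀ p : ℕ, ⋀[ℂ]^(p + 1) L →ₗ[ℂ] ⋀[ℂ]^p L
  | 0 => 0
  | p + 1 =>
    exteriorPower.alternatingMapLinearEquiv
      (AlternatingMap.alternatizeUncurryFin
        (AlternatingMap.alternatizeUncurryFinLM ∘ₗ
          ((1 / 2 : ℂ) • (LieModule.toEnd ℂ L L : L →ₗ[ℂ] L →ₗ[ℂ] L).compr₂
            (AlternatingMap.curryLeft (exteriorPower.ιMulti ℂ (p + 1))))))

/-- In the pair `(i, j)` with `i ≤ j` in `Fin (p + 1)`, the two removed entries are the ones with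
indices `i` and `j + 1` of the tuple `l : Fin (p + 2) → L`. -/
theorem bracketPart_ιMulti (L : Type v) [LieRing L] [LieAlgebra ℂ L] (p : ℕ) (l : Fin (p + 2) → L) :
    bracketPart L (p + 1) (exteriorPower.ιMulti ℂ (p + 2) l) =
      ∑ i : Fin (p + 1), ∑ j ≥ i, (-1 : ℤ) ^ (i + j : ℕ) •
        exteriorPower.ιMulti ℂ (p + 1)
          (Matrix.vecCons ⁅l i.castSucc, l j.succ⁆ (j.removeNth (i.castSucc.removeNth l))) := by
  rw [bracketPart, exteriorPower.alternatingMapLinearEquiv_apply_ιMulti,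
    AlternatingMap.alternatizeUncurryFin_alternatizeUncurryFinLM_comp_apply]
  refine Finset.sum_congr rfl fun i _ => Finset.sum_congr rfl fun j _ => ?_
  congr 1
  have h : ∀ a b : L, ∀ w : Fin p → L,
      ((1 / 2 : ℂ) • (LieModule.toEnd ℂ L L : L →ₗ[ℂ] L →ₗ[ℂ] L).compr₂
        (AlternatingMap.curryLeft (exteriorPower.ιMulti ℂ (p + 1)))) a b w =
      (1 / 2 : ℂ) • AlternatingMap.curryLeft (exteriorPower.ιMulti ℂ (p + 1)) ⁅a, b⁆ w :=
    fun a b w => rfl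
  have e : AlternatingMap.curryLeft (exteriorPower.ιMulti ℂ (p + 1)) ⁅l j.succ, l i.castSucc⁆ =
      -AlternatingMap.curryLeft (exteriorPower.ιMulti ℂ (p + 1)) ⁅l i.castSucc, l j.succ⁆ := by
    rw [← lie_skew, map_neg]
  rw [h, h, e, AlternatingMap.neg_apply, ← AlternatingMap.curryLeft_apply_apply]
  module

variable {X : Type u} [NormedAddCommGroup X] [NormedSpace ℂ X]
  {L : Type v} [LieRing L] [LieAlgebra ℂ L]

/-- `l ↦ (w ↦ (x ↦ ρ(l) x ⊗ w))`. -/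
def actionAux (ρ : L →ₗ[ℂ] X →L[ℂ] X) (p : ℕ) :
    L →ₗ[ℂ] ⋀[ℂ]^p L →ₗ[ℂ] X →ₗ[ℂ] X ⊗[ℂ] ⋀[ℂ]^p L where
  toFun l := ((TensorProduct.mk ℂ X (⋀[ℂ]^p L)).comp (ρ l : X →ₗ[ℂ] X)).flip
  map_add' a b := by ext; simp
  map_smul' c a := by ext; simp [TensorProduct.smul_tmul']

/-- The action part `X ⊗ ⋀^(p+1) L → X ⊗ ⋀^p L` of the Koszul differential:
`x ⊗ l₀ ∧ ⋯ ∧ l_p ↦ ∑ₖ (-1)^k ρ(l_k) x ⊗ l₀ ∧ ⋯ l̂_k ⋯ ∧ l_p` (indices from `0`). -/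
def actionPart (ρ : L →ₗ[ℂ] X →L[ℂ] X) (p : ℕ) :
    X ⊗[ℂ] ⋀[ℂ]^(p + 1) L →ₗ[ℂ] X ⊗[ℂ] ⋀[ℂ]^p L :=
  TensorProduct.lift
    (exteriorPower.alternatingMapLinearEquiv
      (AlternatingMap.alternatizeUncurryFin
        (exteriorPower.alternatingMapLinearEquiv.symm.toLinearMap ∘ₗ actionAux ρ p))).flip

theorem actionPart_tmul_ιMulti (ρ : L →ₗ[ℂ] X →L[ℂ] X) (p : ℕ) (x : X) (l : Fin (p + 1) → L) :
    actionPart ρ p (x ⊗ₜ[ℂ] exteriorPower.ιMulti ℂ (p + 1) l) =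
      ∑ k : Fin (p + 1), (-1 : ℤ) ^ (k : ℕ) •
        (ρ (l k) x ⊗ₜ[ℂ] exteriorPower.ιMulti ℂ p (k.removeNth l)) := by
  simp only [actionPart, TensorProduct.lift.tmul, LinearMap.flip_apply,
    exteriorPower.alternatingMapLinearEquiv_apply_ιMulti,
    AlternatingMap.alternatizeUncurryFin_apply]
  simp [actionAux, LinearMap.sum_apply]

/-- The Koszul (Chevalley–Eilenberg) differential `d_p : X ⊗ ⋀^p L → X ⊗ ⋀^(p-1) L`, with `d_0 = 0`.
It is a differential when `ρ` is a representation. -/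
def diff (ρ : L →ₗ[ℂ] X →L[ℂ] X) :
    ∀ p : ℕ, X ⊗[ℂ] ⋀[ℂ]^p L →ₗ[ℂ] X ⊗[ℂ] ⋀[ℂ]^(p - 1) L
  | 0 => 0
  | p + 1 => actionPart ρ p + (bracketPart L p).lTensor X

/-- The homology `H_p = ker d_p / im d_{p+1}` of the Koszul complex. -/
abbrev Homology (ρ : L →ₗ[ℂ] X →L[ℂ] X) (p : ℕ) : Type _ :=
  (diff ρ p).ker ⧸ (diff ρ (p + 1)).range.submoduleOf (diff ρ p).ker

/-- The contraction `X ⊗ V → X`, `x ⊗ v ↦ φ v • x`, by a linear form `φ` on `V`. -/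
def contract (X : Type*) [NormedAddCommGroup X] [NormedSpace ℂ X] {V : Type*} [AddCommGroup V]
    [Module ℂ V] (φ : Module.Dual ℂ V) : X ⊗[ℂ] V →ₗ[ℂ] X :=
  (TensorProduct.rid ℂ X).toLinearMap ∘ₗ φ.lTensor X

/-- The coarsest topology on `X ⊗ V` that makes all contractions `X ⊗ V → X` continuous. For a
finite dimensional `V` this is the usual Banach space topology of `X ⊗ V ≅ X^(dim V)`,
see `tensorTopology_eq_induced`. -/
abbrev tensorTopology (X : Type*) [NormedAddCommGroup X] [NormedSpace ℂ X] (V : Type*)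
    [AddCommGroup V] [Module ℂ V] : TopologicalSpace (X ⊗[ℂ] V) :=
  ⨅ φ : Module.Dual ℂ V, TopologicalSpace.induced (contract X φ) inferInstance

/-- In terms of any finite basis of `V`, the topology of `X ⊗ V` is the product topology of the
coordinates. -/
theorem tensorTopology_eq_induced (X : Type*) [NormedAddCommGroup X] [NormedSpace ℂ X] {V : Type*}
    [AddCommGroup V] [Module ℂ V] {ι : Type*} [Finite ι] (b : Module.Basis ι ℂ V) :
    tensorTopology X V =
      TopologicalSpace.induced (fun z (i : ι) => contract X (b.coord i) z) inferInstance := by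
  cases nonempty_fintype ι
  apply le_antisymm
  · rw [← continuous_iff_le_induced]
    refine @continuous_pi _ _ _ (tensorTopology X V) _ _ fun i => ?_
    rw [continuous_iff_le_induced]
    exact iInf_le _ (b.coord i)
  · refine le_iInf fun φ => ?_
    rw [← continuous_iff_le_induced]
    have h : ∀ z, contract X φ z = ∑ i, φ (b i) • contract X (b.coord i) z := by
      intro z
      induction z with
      | zero => simp
      | add y z hy hz => simp [hy, hz, Finset.sum_add_distrib]
      | tmul x v =>
        have : φ v = ∑ i, φ (b i) * b.repr v i := by
          conv_lhs => rw [← b.sum_repr v, map_sum]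
          exact Finset.sum_congr rfl fun i _ => by rw [map_smul, smul_eq_mul, mul_comm]
        simp [contract, this, Finset.sum_smul, mul_smul]
    have h' : (contract X φ : X ⊗[ℂ] V → X) =
        (fun w : ι → X => ∑ i, φ (b i) • w i) ∘ fun z i => contract X (b.coord i) z := by
      funext z
      exact h z
    rw [h']
    exact @Continuous.comp _ _ _ (_) _ _ _ _ (by fun_prop) continuous_induced_dom

/-- `f ∈ L*` is a character of `L`: `f` vanishes on all brackets. -/
def IsCharacter (f : Module.Dual ℂ L) : Prop := ∀ a b : L, f ⁅a, b⁆ = 0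

/-- The map `ρ - f · I`. -/
def twist (ρ : L →ₗ[ℂ] X →L[ℂ] X) (f : Module.Dual ℂ L) : L →ₗ[ℂ] X →L[ℂ] X :=
  ρ - f.smulRight (ContinuousLinearMap.id ℂ X)

/-- `σ_p(ρ)`: the characters `f` with `H_p(X ⊗ ⋀ L, d(ρ - f)) ≠ 0`. -/
def sigma (ρ : L →ₗ⁅ℂ⁆ X →L[ℂ] X) (p : ℕ) : Set (Module.Dual ℂ L) :=
  {f | IsCharacter f ∧ Nontrivial (Homology (twist (ρ : L →ₗ[ℂ] X →L[ℂ] X) f) p)}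

/-- The Taylor joint spectrum `σ(ρ) = ⋃_{p=0}^n σ_p(ρ)`, `n = dim L`. -/
def taylorSpectrum (ρ : L →ₗ⁅ℂ⁆ X →L[ℂ] X) : Set (Module.Dual ℂ L) :=
  ⋃ p ∈ Set.Icc 0 (Module.finrank ℂ L), sigma ρ p

/-- The `δ`-Słodkowski joint spectrum `σ_{δ,k}(ρ) = ⋃_{p=0}^k σ_p(ρ)`. -/
def deltaSpectrum (ρ : L →ₗ⁅ℂ⁆ X →L[ℂ] X) (k : ℕ) : Set (Module.Dual ℂ L) :=
  ⋃ p ∈ Set.Icc 0 k, sigma ρ p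

/-- The `π`-Słodkowski joint spectrum: the union of `⋃_{p=n-k}^n σ_p(ρ)` and of the characters `f`
for which the range of `d_{n-k}(ρ - f)` is not closed (`0 ≤ k ≤ n = dim L`). -/
def piSpectrum (ρ : L →ₗ⁅ℂ⁆ X →L[ℂ] X) (k : ℕ) : Set (Module.Dual ℂ L) :=
  (⋃ p ∈ Set.Icc (Module.finrank ℂ L - k) (Module.finrank ℂ L), sigma ρ p) ∪
    {f | IsCharacter f ∧
      ¬ IsClosed[tensorTopology X (⋀[ℂ]^(Module.finrank ℂ L - k - 1) L)]
        ((diff (twist (ρ : L →ₗ[ℂ] X →L[ℂ] X) f) (Module.finrank ℂ L - k)).range :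
          Set (X ⊗[ℂ] ⋀[ℂ]^(Module.finrank ℂ L - k - 1) L))}

/-- The characters `f` of `L` with a joint eigenvector: `ρ(l) x = f(l) x` for all `l`, for some
`x ≠ 0`. -/
def eigenCharacters (ρ : L →ₗ⁅ℂ⁆ X →L[ℂ] X) : Set (Module.Dual ℂ L) :=
  {f | IsCharacter f ∧ ∃ x : X, x ≠ 0 ∧ ∀ l : L, ρ l x = f l • x}

end LieKoszul

end

/-!
Write `θ = ρ - f` for a character `f`. At `f = 0` the differential `d₁` is not onto, since it would
give a compact surjection onto the infinite-dimensional space `X`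
(`range_diff_one_ne_top_of_compact`). So let `f ≠ 0`, and choose `l` with `f l ≠ 0`. Then `θ(l)` is a
nonzero scalar perturbation of a compact operator, and by Riesz theory
(`exists_riesz_decomposition`) `X` is the direct sum of the finite-dimensional generalized null
space `N` of `θ(l)` and of a complement on which `θ(l)` is invertible. Since `L` is nilpotent, both
are `L`-invariant (`exists_fitting`).

The homology is controlled by Cartan's formula `d ∘ i_l + i_l ∘ d = θ(l) ⊗ 1 + 1 ⊗ ad l`
(`diff_insertion`), where `i_l` is exterior multiplication by `l`. As `ad l` is nilpotent, the
right-hand side is invertible over every invariant summand on which `θ(l)` is invertible, so such a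
summand contributes nothing to the homology (`killsHomology_of_inverse`). Applying this repeatedly
inside `N`, and Engel's theorem at the end, shows that the whole complex is exact unless `N`, that
is `X`, has a joint eigenvector for `f` (`killsHomology_of_finiteDimensional`,
`ker_diff_le_range_diff`). In the exact case every range is a kernel of a continuous map, hence
closed (`isClosed_ker_diff`).

Conversely, a joint eigenvector `x` gives homology at both ends of the complex. In degree `n` the
bracket part of `d_n` vanishes because nilpotent Lie algebras are unimodular
(`bracketPart_top_eq_zero`), so `x ⊗ w` is a cycle (`exists_top_cycle`). In degree `0`, the zero
weight space of `N` is a nonzero nilpotent direct summand, so `L · N ≠ N`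
(`range_diff_one_ne_top_of_invariant`).
-/

noncomputable section

namespace LieKoszul

/-! ### Wedge products and contractions in exterior powers -/

section Exterior

variable {V : Type*} [AddCommGroup V] [Module ℂ V]

/-- Exterior multiplication `w ↦ l ∧ w`, linear in `l`. -/
def wedge (p : ℕ) : V →ₗ[ℂ] ⋀[ℂ]^p V →ₗ[ℂ] ⋀[ℂ]^(p + 1) V :=
  exteriorPower.alternatingMapLinearEquiv.toLinearMap ∘ₗ
    AlternatingMap.curryLeft (exteriorPower.ιMulti ℂ (p + 1))

theorem wedge_ιMulti (p : ℕ) (l : V) (w : Fin p → V) :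
    wedge p l (exteriorPower.ιMulti ℂ p w) =
      exteriorPower.ιMulti ℂ (p + 1) (Matrix.vecCons l w) := by
  simp only [wedge, LinearMap.comp_apply, LinearEquiv.coe_coe,
    exteriorPower.alternatingMapLinearEquiv_apply_ιMulti, AlternatingMap.curryLeft_apply_apply]

/-- `⋀^(p+1) V` is spanned by the products `l ∧ w`; this is the induction principle in the degree. -/
theorem hom_ext_wedge {N : Type*} [AddCommGroup N] [Module ℂ N] {p : ℕ}
    {f g : ⋀[ℂ]^(p + 1) V →ₗ[ℂ] N} (h : ∀ l w, f (wedge p l w) = g (wedge p l w)) : f = g := by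
  refine exteriorPower.linearMap_ext (AlternatingMap.ext fun v => ?_)
  have := h (v 0) (exteriorPower.ιMulti ℂ p (Fin.tail v))
  rw [wedge_ιMulti] at this
  have e : Matrix.vecCons (v 0) (Fin.tail v) = v := Fin.cons_self_tail v
  rw [e] at this
  exact this

theorem wedge_wedge (p : ℕ) (a b : V) (w : ⋀[ℂ]^p V) :
    wedge (p + 1) a (wedge p b w) = -wedge (p + 1) b (wedge p a w) := by
  have : wedge (p + 1) a ∘ₗ wedge p b = -(wedge (p + 1) b ∘ₗ wedge p a) := by
    refine exteriorPower.linearMap_ext (AlternatingMap.ext fun v => ?_)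
    simp only [LinearMap.compAlternatingMap_apply, LinearMap.comp_apply, LinearMap.neg_apply,
      wedge_ιMulti]
    have h := AlternatingMap.map_swap (exteriorPower.ιMulti ℂ (p + 2))
      (Matrix.vecCons b (Matrix.vecCons a v)) (i := 0) (j := 1) (by simp)
    rw [← h]
    congr 1
    ext i
    refine Fin.cases ?_ (fun i => Fin.cases ?_ (fun i => ?_) i) i
    · simp
    · simp
    · rw [Function.comp_apply, Equiv.swap_apply_of_ne_of_ne]
      · simp
      · exact Fin.succ_ne_zero _
      · exact fun h => Fin.succ_ne_zero i (Fin.succ_injective _ h)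
  exact LinearMap.congr_fun this w

theorem removeNth_zero_vecCons {α : Type*} {n : ℕ} (a : α) (w : Fin n → α) :
    (0 : Fin (n + 1)).removeNth (Matrix.vecCons a w) = w := by
  ext i; simp [Fin.removeNth]

theorem removeNth_succ_vecCons {α : Type*} {n : ℕ} (j : Fin (n + 1)) (a : α)
    (w : Fin (n + 1) → α) :
    j.succ.removeNth (Matrix.vecCons a w) = Matrix.vecCons a (j.removeNth w) := by
  ext i
  refine Fin.cases ?_ (fun i => ?_) i
  · simp [Fin.removeNth]
  · simp [Fin.removeNth, Fin.succ_succAbove_succ]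

theorem alternatizeUncurryFin_vecCons {N : Type*} [AddCommGroup N] [Module ℂ N] {n : ℕ}
    (f : V →ₗ[ℂ] V [⋀^Fin (n + 1)]→ₗ[ℂ] N) (l : V) (w : Fin (n + 1) → V) :
    AlternatingMap.alternatizeUncurryFin f (Matrix.vecCons l w) =
      f l w - ∑ j : Fin (n + 1), (-1 : ℤ) ^ (j : ℕ) •
        f (w j) (Matrix.vecCons l (j.removeNth w)) := by
  rw [AlternatingMap.alternatizeUncurryFin_apply, Fin.sum_univ_succ]
  simp only [removeNth_zero_vecCons, removeNth_succ_vecCons, Fin.val_succ, pow_succ,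
    Matrix.cons_val_zero, Matrix.cons_val_succ, Fin.val_zero]
  simp [sub_eq_add_neg, Finset.sum_neg_distrib]

/-- Contraction `⋀^(p+1) V → ⋀^p V` by a linear form `φ`, characterized by
`contraction_wedge`. -/
def contraction (φ : Module.Dual ℂ V) (p : ℕ) : ⋀[ℂ]^(p + 1) V →ₗ[ℂ] ⋀[ℂ]^p V :=
  exteriorPower.alternatingMapLinearEquiv
    (AlternatingMap.alternatizeUncurryFin (φ.smulRight (exteriorPower.ιMulti ℂ p)))

theorem contraction_wedge_zero (φ : Module.Dual ℂ V) (l : V) (w : ⋀[ℂ]^0 V) :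
    contraction φ 0 (wedge 0 l w) = φ l • w := by
  have : contraction φ 0 ∘ₗ wedge 0 l = φ l • LinearMap.id := by
    refine exteriorPower.linearMap_ext (AlternatingMap.ext fun v => ?_)
    simp only [LinearMap.compAlternatingMap_apply, LinearMap.comp_apply, wedge_ιMulti, contraction,
      exteriorPower.alternatingMapLinearEquiv_apply_ιMulti,
      AlternatingMap.alternatizeUncurryFin_apply, LinearMap.smul_apply]
    simp
  exact LinearMap.congr_fun this w

theorem contraction_wedge (φ : Module.Dual ℂ V) (p : ℕ) (l : V) (w : ⋀[ℂ]^(p + 1) V) :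
    contraction φ (p + 1) (wedge (p + 1) l w) = φ l • w - wedge p l (contraction φ p w) := by
  have : contraction φ (p + 1) ∘ₗ wedge (p + 1) l =
      φ l • LinearMap.id - wedge p l ∘ₗ contraction φ p := by
    refine exteriorPower.linearMap_ext (AlternatingMap.ext fun v => ?_)
    simp only [LinearMap.compAlternatingMap_apply, LinearMap.comp_apply, wedge_ιMulti, contraction,
      exteriorPower.alternatingMapLinearEquiv_apply_ιMulti, LinearMap.sub_apply,
      alternatizeUncurryFin_vecCons, LinearMap.smul_apply, LinearMap.id_apply]
    simp only [AlternatingMap.alternatizeUncurryFin_apply, map_sum, map_zsmul,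
      LinearMap.smulRight_apply, AlternatingMap.smul_apply, map_smul, wedge_ιMulti]
  exact LinearMap.congr_fun this w

/-- Euler's identity: contracting and wedging back counts the degree. -/
theorem sum_wedge_contraction {ι : Type*} [Fintype ι] (b : Module.Basis ι ℂ V) (p : ℕ)
    (w : ⋀[ℂ]^(p + 1) V) :
    ∑ i, wedge p (b i) (contraction (b.coord i) p w) = ((p : ℂ) + 1) • w := by
  have hb : ∀ (q : ℕ) (l : V) (u : ⋀[ℂ]^q V), ∑ i, b.coord i l • wedge q (b i) u = wedge q l u := by
    intro q l u
    conv_rhs => rw [← b.sum_repr l, map_sum, LinearMap.sum_apply]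
    simp
  induction p with
  | zero =>
    have : ∑ i, wedge 0 (b i) ∘ₗ contraction (b.coord i) 0 = LinearMap.id := by
      refine hom_ext_wedge fun l u => ?_
      simp only [LinearMap.sum_apply, LinearMap.comp_apply, contraction_wedge_zero, map_smul,
        LinearMap.id_apply, hb]
    simpa using LinearMap.congr_fun this w
  | succ p ih =>
    have : ∑ i, wedge (p + 1) (b i) ∘ₗ contraction (b.coord i) (p + 1) =
        (((p + 1 : ℕ) : ℂ) + 1) • LinearMap.id := by
      refine hom_ext_wedge fun l u => ?_
      simp only [LinearMap.sum_apply, LinearMap.comp_apply, contraction_wedge, map_sub, map_smul,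
        LinearMap.id_apply, LinearMap.smul_apply, Finset.sum_sub_distrib, hb,
        wedge_wedge p (b _) l, Finset.sum_neg_distrib, ← map_sum, ih]
      push_cast
      module
    simpa using LinearMap.congr_fun this w

/-- The wedge pairing `V × ⋀^q V → ⋀^(q+1) V` is nondegenerate in its second argument for
`q < dim V`. -/
theorem eq_zero_of_forall_wedge_eq_zero [FiniteDimensional ℂ V] {q : ℕ}
    (hq : q < Module.finrank ℂ V) (u : ⋀[ℂ]^q V) (hu : ∀ l : V, wedge q l u = 0) : u = 0 := by
  let b := Module.finBasis ℂ V
  cases q with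
  | zero =>
    have h := contraction_wedge_zero (b.coord ⟨0, hq⟩) (b ⟨0, hq⟩) u
    rw [hu, map_zero] at h
    simpa using h.symm
  | succ q =>
    have h : ∑ i, contraction (b.coord i) (q + 1) (wedge (q + 1) (b i) u) = 0 := by simp [hu]
    simp only [contraction_wedge, Finset.sum_sub_distrib, sum_wedge_contraction] at h
    simp only [Module.Basis.coord_apply, Module.Basis.repr_self, Finsupp.single_eq_same, one_smul,
      Finset.sum_const, Finset.card_univ, Fintype.card_fin, ← Nat.cast_smul_eq_nsmul ℂ,
      ← sub_smul] at h
    refine (smul_eq_zero.mp h).resolve_left (sub_ne_zero.mpr ?_)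
    exact_mod_cast hq.ne'

end Exterior

/-! ### The adjoint action and the bracket differential on exterior powers -/

section Adjoint

variable {L : Type*} [LieRing L] [LieAlgebra ℂ L]

/-- The action of `m : L` on `⋀^p L` as the derivation extending `ad m`, encoded as
`l₁ ∧ ⋯ ∧ l_p ↦ ∑ⱼ (-1)^(j+1) [m, l_j] ∧ l₁ ∧ ⋯ l̂_j ⋯ ∧ l_p`. -/
def adExt (m : L) : ∀ p : ℕ, ⋀[ℂ]^p L →ₗ[ℂ] ⋀[ℂ]^p L
  | 0 => 0
  | p + 1 => exteriorPower.alternatingMapLinearEquiv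
      (AlternatingMap.alternatizeUncurryFin
        (AlternatingMap.curryLeft (exteriorPower.ιMulti ℂ (p + 1)) ∘ₗ
          (LieModule.toEnd ℂ L L m : L →ₗ[ℂ] L)))

theorem adExt_ιMulti (m : L) (p : ℕ) (v : Fin (p + 1) → L) :
    adExt m (p + 1) (exteriorPower.ιMulti ℂ (p + 1) v) =
      ∑ j : Fin (p + 1), (-1 : ℤ) ^ (j : ℕ) •
        wedge p ⁅m, v j⁆ (exteriorPower.ιMulti ℂ p (j.removeNth v)) := by
  simp only [adExt, exteriorPower.alternatingMapLinearEquiv_apply_ιMulti, wedge_ιMulti,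
    AlternatingMap.alternatizeUncurryFin_apply, LinearMap.comp_apply,
    AlternatingMap.curryLeft_apply_apply]
  rfl

theorem adExt_wedge (m : L) (p : ℕ) (l : L) (w : ⋀[ℂ]^p L) :
    adExt m (p + 1) (wedge p l w) = wedge p ⁅m, l⁆ w + wedge p l (adExt m p w) := by
  have : adExt m (p + 1) ∘ₗ wedge p l = wedge p ⁅m, l⁆ + wedge p l ∘ₗ adExt m p := by
    refine exteriorPower.linearMap_ext (AlternatingMap.ext fun v => ?_)
    simp only [LinearMap.compAlternatingMap_apply, LinearMap.comp_apply, LinearMap.add_apply]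
    rw [wedge_ιMulti, adExt_ιMulti, Fin.sum_univ_succ]
    cases p with
    | zero => simp [adExt]
    | succ p =>
      simp only [removeNth_zero_vecCons, removeNth_succ_vecCons, adExt_ιMulti, map_sum, map_zsmul,
        ← wedge_ιMulti]
      simp only [wedge_wedge p l]
      simp [pow_succ, Finset.sum_neg_distrib]
  exact LinearMap.congr_fun this w

theorem adExt_lie (m l : L) (p : ℕ) (w : ⋀[ℂ]^p L) :
    adExt ⁅m, l⁆ p w = adExt m p (adExt l p w) - adExt l p (adExt m p w) := by
  induction p with
  | zero => simp [adExt]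
  | succ p ih =>
    have : adExt ⁅m, l⁆ (p + 1) =
        adExt m (p + 1) ∘ₗ adExt l (p + 1) - adExt l (p + 1) ∘ₗ adExt m (p + 1) := by
      refine hom_ext_wedge fun a u => ?_
      simp only [LinearMap.sub_apply, LinearMap.comp_apply, adExt_wedge, map_add, ih, map_sub,
        lie_lie, LinearMap.sub_apply]
      abel
    exact LinearMap.congr_fun this w

/-- Cartan's formula `∂ (l ∧ w) + l ∧ ∂ w = ad l w` on `⋀ L`. -/
theorem bracketPart_wedge (p : ℕ) (l : L) (w : ⋀[ℂ]^(p + 1) L) :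
    bracketPart L (p + 1) (wedge (p + 1) l w) =
      adExt l (p + 1) w - wedge p l (bracketPart L p w) := by
  have : bracketPart L (p + 1) ∘ₗ wedge (p + 1) l =
      adExt l (p + 1) - wedge p l ∘ₗ bracketPart L p := by
    refine exteriorPower.linearMap_ext (AlternatingMap.ext fun v => ?_)
    simp only [LinearMap.compAlternatingMap_apply, LinearMap.comp_apply, LinearMap.sub_apply]
    rw [wedge_ιMulti, bracketPart_ιMulti, adExt_ιMulti]
    cases p with
    | zero =>
      simp [bracketPart, wedge_ιMulti]
    | succ p =>
      rw [Fin.sum_univ_succ, bracketPart_ιMulti, sub_eq_add_neg]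
      congr 1
      · refine Finset.sum_congr (by ext; simp) fun j _ => ?_
        rw [wedge_ιMulti, Fin.castSucc_zero, removeNth_zero_vecCons]
        simp
      · rw [map_sum, ← Finset.sum_neg_distrib]
        refine Finset.sum_congr rfl fun i _ => ?_
        rw [map_sum, ← Finset.sum_neg_distrib, ← Fin.map_succEmb_Ici, Finset.sum_map]
        refine Finset.sum_congr rfl fun j _ => ?_
        rw [Fin.coe_succEmb, ← Fin.succ_castSucc, removeNth_succ_vecCons, removeNth_succ_vecCons,
          map_zsmul, ← wedge_ιMulti, ← wedge_ιMulti, ← wedge_ιMulti, wedge_wedge _ l]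
        simp only [Fin.val_succ, Matrix.cons_val_succ]
        rw [show (i : ℕ) + 1 + ((j : ℕ) + 1) = i + j + 2 by ring, pow_add]
        simp
  exact LinearMap.congr_fun this w

/-- By induction on the degree: `L ⊗ ⋀^p L → ⋀^(p+1) L`, `l ⊗ w ↦ l ∧ w` is onto and intertwines the
sum of the commuting nilpotent operators `ad m ⊗ 1` and `1 ⊗ ad m` with `ad m`. -/
theorem isNilpotent_adExt [LieRing.IsNilpotent L] (m : L) (p : ℕ) :
    IsNilpotent (adExt m p) := by
  induction p with
  | zero => exact IsNilpotent.zero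
  | succ p ih =>
    obtain ⟨N, hN⟩ := LieAlgebra.nilpotent_ad_of_nilpotent_algebra ℂ L
    let W : L ⊗[ℂ] ⋀[ℂ]^p L →ₗ[ℂ] ⋀[ℂ]^(p + 1) L := TensorProduct.lift (wedge p)
    let a : Module.End ℂ (L ⊗[ℂ] ⋀[ℂ]^p L) := (LieAlgebra.ad ℂ L m : L →ₗ[ℂ] L).rTensor _
    let b : Module.End ℂ (L ⊗[ℂ] ⋀[ℂ]^p L) := (adExt m p).lTensor L
    have hab : Commute a b := by ext; simp [a, b]
    have ha : IsNilpotent a := ⟨N, by simp [a, LinearMap.rTensor_pow, hN]⟩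
    have hb : IsNilpotent b := by
      obtain ⟨k, hk⟩ := ih
      exact ⟨k, by simp [b, LinearMap.lTensor_pow, hk]⟩
    obtain ⟨k, hk⟩ := hab.isNilpotent_add ha hb
    have hW : adExt m (p + 1) ∘ₗ W = W ∘ₗ (a + b) := by
      refine TensorProduct.ext' fun l w => ?_
      simp [W, a, b, adExt_wedge]
    have hW' := Module.End.commute_pow_left_of_commute hW k
    refine ⟨k, hom_ext_wedge fun l w => ?_⟩
    have := LinearMap.congr_fun hW' (l ⊗ₜ w)
    rw [hk] at this
    simpa [W] using this

/-- A nilpotent Lie algebra is unimodular: the bracket differential vanishes in top degree.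
By Cartan's formula `l ∧ ∂ w = ad l w`, and `ad l` is a nilpotent operator on a line. -/
theorem bracketPart_top_eq_zero [FiniteDimensional ℂ L] [LieRing.IsNilpotent L] {p : ℕ}
    (hp : p + 1 = Module.finrank ℂ L) : bracketPart L p = 0 := by
  have hfin : ∀ q, Module.finrank ℂ (⋀[ℂ]^q L) = (Module.finrank ℂ L).choose q :=
    fun q => exteriorPower.finrank_eq ℂ q
  have h1 : Module.finrank ℂ (⋀[ℂ]^(p + 1) L) = 1 := by rw [hfin, hp, Nat.choose_self]
  have h2 : Subsingleton (⋀[ℂ]^(p + 1 + 1) L) := by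
    rw [← Module.finrank_zero_iff (R := ℂ), hfin, Nat.choose_eq_zero_of_lt (by omega)]
  ext1
  refine AlternatingMap.ext fun v => ?_
  refine eq_zero_of_forall_wedge_eq_zero (by omega) _ fun l => ?_
  have h3 : adExt l (p + 1) = 0 := by
    obtain ⟨c, hc, -⟩ := LinearMap.existsUnique_eq_smul_id_of_finrank_eq_one h1 (adExt l (p + 1))
    obtain ⟨k, hk⟩ := isNilpotent_adExt l (p + 1)
    have : Nontrivial (⋀[ℂ]^(p + 1) L) := Module.nontrivial_of_finrank_pos (R := ℂ) (by omega)
    have hc' : (c • (1 : Module.End ℂ (⋀[ℂ]^(p + 1) L))) ^ k = 0 := by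
      rw [← hk, hc]
      rfl
    rw [smul_pow, one_pow, smul_eq_zero_iff_left one_ne_zero] at hc'
    rw [hc, eq_zero_of_pow_eq_zero hc', zero_smul]
  have h4 := bracketPart_wedge p l (exteriorPower.ιMulti ℂ (p + 1) v)
  rw [Subsingleton.elim (wedge (p + 1) l _) 0, map_zero, h3, LinearMap.zero_apply, zero_sub,
    zero_eq_neg] at h4
  exact h4

end Adjoint

/-! ### Cartan calculus on the Koszul complex -/

section Complex

variable {X : Type*} [NormedAddCommGroup X] [NormedSpace ℂ X]
  {L : Type*} [LieRing L] [LieAlgebra ℂ L]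

/-- `x ⊗ w ↦ x ⊗ (l ∧ w)`. By Cartan's formula this is a homotopy from `0` to the action of `l`. -/
def insertion (X : Type*) [NormedAddCommGroup X] [NormedSpace ℂ X] (l : L) (p : ℕ) :
    X ⊗[ℂ] ⋀[ℂ]^p L →ₗ[ℂ] X ⊗[ℂ] ⋀[ℂ]^(p + 1) L :=
  (wedge p l).lTensor X

/-- The action `θ(l) ⊗ 1 + 1 ⊗ ad l` of `l` on `X ⊗ ⋀^p L`. -/
def lieDeriv (θ : L →ₗ[ℂ] X →L[ℂ] X) (l : L) (p : ℕ) : Module.End ℂ (X ⊗[ℂ] ⋀[ℂ]^p L) :=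
  (θ l : X →ₗ[ℂ] X).rTensor _ + (adExt l p).lTensor X

theorem hom_ext_insertion {N : Type*} [AddCommGroup N] [Module ℂ N] {p : ℕ}
    {f g : X ⊗[ℂ] ⋀[ℂ]^(p + 1) L →ₗ[ℂ] N}
    (h : ∀ l z, f (insertion X l p z) = g (insertion X l p z)) : f = g := by
  refine TensorProduct.ext (LinearMap.ext fun x => hom_ext_wedge fun l w => ?_)
  simpa [insertion] using h l (x ⊗ₜ w)

theorem hom_ext_tmul_ιMulti {N : Type*} [AddCommGroup N] [Module ℂ N] {p : ℕ}
    {f g : X ⊗[ℂ] ⋀[ℂ]^p L →ₗ[ℂ] N}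
    (h : ∀ x v, f (x ⊗ₜ exteriorPower.ιMulti ℂ p v) = g (x ⊗ₜ exteriorPower.ιMulti ℂ p v)) :
    f = g := by
  refine TensorProduct.ext (LinearMap.ext fun x => exteriorPower.linearMap_ext
    (AlternatingMap.ext fun v => ?_))
  simpa using h x v

theorem actionPart_insertion_zero (θ : L →ₗ[ℂ] X →L[ℂ] X) (l : L) (z : X ⊗[ℂ] ⋀[ℂ]^0 L) :
    actionPart θ 0 (insertion X l 0 z) = (θ l : X →ₗ[ℂ] X).rTensor _ z := by
  have : actionPart θ 0 ∘ₗ insertion X l 0 = (θ l : X →ₗ[ℂ] X).rTensor _ := by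
    refine hom_ext_tmul_ιMulti fun x v => ?_
    simp only [LinearMap.comp_apply, insertion, LinearMap.lTensor_tmul, LinearMap.rTensor_tmul,
      wedge_ιMulti, actionPart_tmul_ιMulti, Fin.sum_univ_succ, removeNth_zero_vecCons]
    simp
  exact LinearMap.congr_fun this z

theorem actionPart_insertion (θ : L →ₗ[ℂ] X →L[ℂ] X) (l : L) (p : ℕ)
    (z : X ⊗[ℂ] ⋀[ℂ]^(p + 1) L) :
    actionPart θ (p + 1) (insertion X l (p + 1) z) =
      (θ l : X →ₗ[ℂ] X).rTensor _ z - insertion X l p (actionPart θ p z) := by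
  have : actionPart θ (p + 1) ∘ₗ insertion X l (p + 1) =
      (θ l : X →ₗ[ℂ] X).rTensor _ - insertion X l p ∘ₗ actionPart θ p := by
    refine hom_ext_tmul_ιMulti fun x v => ?_
    simp only [LinearMap.comp_apply, LinearMap.sub_apply, insertion, LinearMap.lTensor_tmul,
      LinearMap.rTensor_tmul, wedge_ιMulti, actionPart_tmul_ιMulti, map_sum, map_zsmul]
    rw [Fin.sum_univ_succ, sub_eq_add_neg, ← Finset.sum_neg_distrib]
    simp only [removeNth_zero_vecCons, removeNth_succ_vecCons]
    simp [pow_succ]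
  exact LinearMap.congr_fun this z

/-- Cartan's formula in degree `0`. -/
theorem diff_insertion_zero (θ : L →ₗ[ℂ] X →L[ℂ] X) (l : L) (z : X ⊗[ℂ] ⋀[ℂ]^0 L) :
    diff θ 1 (insertion X l 0 z) = lieDeriv θ l 0 z := by
  have h : (bracketPart L 0).lTensor X (insertion X l 0 z) = (adExt l 0).lTensor X z := by
    simp [bracketPart, adExt]
  simp only [diff, lieDeriv, LinearMap.add_apply, h, actionPart_insertion_zero]

/-- Cartan's formula `d ∘ i_l + i_l ∘ d = θ(l) ⊗ 1 + 1 ⊗ ad l`. -/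
theorem diff_insertion (θ : L →ₗ[ℂ] X →L[ℂ] X) (l : L) (p : ℕ) (z : X ⊗[ℂ] ⋀[ℂ]^(p + 1) L) :
    diff θ (p + 2) (insertion X l (p + 1) z) =
      lieDeriv θ l (p + 1) z - insertion X l p (diff θ (p + 1) z) := by
  have h : (bracketPart L (p + 1)).lTensor X (insertion X l (p + 1) z) =
      (adExt l (p + 1)).lTensor X z - insertion X l p ((bracketPart L p).lTensor X z) := by
    have : (bracketPart L (p + 1)).lTensor X ∘ₗ insertion X l (p + 1) =
        (adExt l (p + 1)).lTensor X - insertion X l p ∘ₗ (bracketPart L p).lTensor X := by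
      refine TensorProduct.ext' fun x w => ?_
      simp [insertion, bracketPart_wedge, TensorProduct.tmul_sub]
    exact LinearMap.congr_fun this z
  simp only [diff, lieDeriv, LinearMap.add_apply, h, actionPart_insertion, map_add,
    Nat.add_one_sub_one]
  abel

/-- `θ` respects brackets. -/
def IsRep (θ : L →ₗ[ℂ] X →L[ℂ] X) : Prop :=
  ∀ a b x, θ ⁅a, b⁆ x = θ a (θ b x) - θ b (θ a x)

theorem lieDeriv_insertion (θ : L →ₗ[ℂ] X →L[ℂ] X) (m l : L) (p : ℕ) (z : X ⊗[ℂ] ⋀[ℂ]^p L) :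
    lieDeriv θ m (p + 1) (insertion X l p z) =
      insertion X ⁅m, l⁆ p z + insertion X l p (lieDeriv θ m p z) := by
  have : lieDeriv θ m (p + 1) ∘ₗ insertion X l p =
      insertion X ⁅m, l⁆ p + insertion X l p ∘ₗ lieDeriv θ m p := by
    refine TensorProduct.ext' fun x w => ?_
    simp only [lieDeriv, insertion, LinearMap.comp_apply, LinearMap.add_apply,
      LinearMap.lTensor_tmul, LinearMap.rTensor_tmul, adExt_wedge, TensorProduct.tmul_add, map_add]
    abel
  exact LinearMap.congr_fun this z

theorem lieDeriv_lie {θ : L →ₗ[ℂ] X →L[ℂ] X} (hθ : IsRep θ) (m l : L) (p : ℕ)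
    (z : X ⊗[ℂ] ⋀[ℂ]^p L) :
    lieDeriv θ ⁅m, l⁆ p z =
      lieDeriv θ m p (lieDeriv θ l p z) - lieDeriv θ l p (lieDeriv θ m p z) := by
  have : lieDeriv θ ⁅m, l⁆ p =
      lieDeriv θ m p ∘ₗ lieDeriv θ l p - lieDeriv θ l p ∘ₗ lieDeriv θ m p := by
    refine TensorProduct.ext' fun x w => ?_
    simp only [lieDeriv, LinearMap.comp_apply, LinearMap.add_apply, LinearMap.sub_apply,
      LinearMap.lTensor_tmul, LinearMap.rTensor_tmul, adExt_lie, TensorProduct.tmul_sub, map_add,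
      ContinuousLinearMap.coe_coe, hθ m l x, TensorProduct.sub_tmul]
    abel
  exact LinearMap.congr_fun this z

/-- The differential is equivariant. By induction on the degree: the commutator of `d` with the
action of `m` anticommutes with the insertions, by Cartan's formula, and insertions generate. -/
theorem diff_lieDeriv {θ : L →ₗ[ℂ] X →L[ℂ] X} (hθ : IsRep θ) (m : L) (p : ℕ)
    (z : X ⊗[ℂ] ⋀[ℂ]^(p + 1) L) :
    diff θ (p + 1) (lieDeriv θ m (p + 1) z) = lieDeriv θ m p (diff θ (p + 1) z) := by
  induction p with
  | zero =>
    have : diff θ 1 ∘ₗ lieDeriv θ m 1 = lieDeriv θ m 0 ∘ₗ diff θ 1 := by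
      refine hom_ext_insertion fun l z => ?_
      simp only [LinearMap.comp_apply]
      rw [lieDeriv_insertion, map_add, diff_insertion_zero, diff_insertion_zero,
        diff_insertion_zero, lieDeriv_lie hθ, sub_add_cancel]
    exact LinearMap.congr_fun this z
  | succ p ih =>
    have : diff θ (p + 2) ∘ₗ lieDeriv θ m (p + 2) = lieDeriv θ m (p + 1) ∘ₗ diff θ (p + 2) := by
      refine hom_ext_insertion fun l z => ?_
      simp only [LinearMap.comp_apply]
      rw [lieDeriv_insertion, map_add, diff_insertion, diff_insertion, diff_insertion, map_sub,
        lieDeriv_insertion, ih, lieDeriv_lie hθ]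
      abel
    exact LinearMap.congr_fun this z

theorem diff_diff {θ : L →ₗ[ℂ] X →L[ℂ] X} (hθ : IsRep θ) (p : ℕ) (z : X ⊗[ℂ] ⋀[ℂ]^(p + 2) L) :
    diff θ (p + 1) (diff θ (p + 2) z) = 0 := by
  induction p with
  | zero =>
    have : diff θ 1 ∘ₗ diff θ 2 = 0 := by
      refine hom_ext_insertion fun l z => ?_
      rw [LinearMap.comp_apply, diff_insertion, map_sub]
      simp only [Nat.add_one_sub_one]
      rw [diff_insertion_zero, diff_lieDeriv hθ, sub_self, LinearMap.zero_apply]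
    exact LinearMap.congr_fun this z
  | succ p ih =>
    have : diff θ (p + 2) ∘ₗ diff θ (p + 3) = 0 := by
      refine hom_ext_insertion fun l z => ?_
      rw [LinearMap.comp_apply, diff_insertion, map_sub]
      simp only [Nat.add_one_sub_one]
      rw [diff_insertion, diff_lieDeriv hθ, ih, map_zero, sub_zero, sub_self, LinearMap.zero_apply]
    exact LinearMap.congr_fun this z

/-- An operator that commutes with `θ` induces an endomorphism of the Koszul complex. -/
theorem diff_rTensor {θ : L →ₗ[ℂ] X →L[ℂ] X} {P : Module.End ℂ X}
    (hP : ∀ l x, P (θ l x) = θ l (P x)) (p : ℕ) (z : X ⊗[ℂ] ⋀[ℂ]^(p + 1) L) :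
    diff θ (p + 1) (P.rTensor _ z) = P.rTensor _ (diff θ (p + 1) z) := by
  have : diff θ (p + 1) ∘ₗ P.rTensor _ = P.rTensor (⋀[ℂ]^p L) ∘ₗ diff θ (p + 1) := by
    refine hom_ext_tmul_ιMulti fun x v => ?_
    simp only [diff, LinearMap.comp_apply, LinearMap.add_apply, LinearMap.rTensor_tmul,
      LinearMap.lTensor_tmul, actionPart_tmul_ιMulti, map_add, map_sum, map_zsmul, hP]
  exact LinearMap.congr_fun this z

/-- If `t` is invertible relative to `e` with relative inverse `s`, then so is its perturbation by a
commuting nilpotent `b`, with relative inverse `(1 + s b)⁻¹ s`. -/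
theorem exists_inverse_add_of_isNilpotent {A : Type*} [Ring A] {t s e b : A} (hts : t * s = e)
    (hst : s * t = e) (hes : e * s = s) (hbt : Commute b t) (hbs : Commute b s)
    (hb : IsNilpotent b) :
    ∃ g, (t + b) * g = e ∧ g * (t + b) = e ∧ e * g = g := by
  have hse : s * e = s := by rw [← hts, ← mul_assoc, hst, hes]
  have hct : Commute s t := hst.trans hts.symm
  have hbe : Commute b e := hts ▸ hbt.mul_right hbs
  have hsbn : IsNilpotent (s * b) := hbs.symm.isNilpotent_mul_left hb
  obtain ⟨u, hu⟩ : IsUnit (1 + s * b) := by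
    rw [add_comm]; exact hsbn.isUnit_add_one
  have cs : Commute (1 + s * b) s :=
    (Commute.one_left s).add_left ((Commute.refl s).mul_left hbs)
  have ct : Commute (1 + s * b) t :=
    (Commute.one_left t).add_left (hct.mul_left hbt)
  have cb : Commute (1 + s * b) b :=
    (Commute.one_left b).add_left (hbs.symm.mul_left (Commute.refl b))
  have ce : Commute (1 + s * b) e := hts ▸ ct.mul_right cs
  rw [← hu] at cs ct cb ce
  have ctb : Commute (↑u⁻¹ : A) (t + b) := (ct.add_right cb).units_inv_left
  have key : (t + b) * s = u * e := by
    rw [add_mul, hts, hu, add_mul, one_mul, mul_assoc, hbe.eq, ← mul_assoc, hse, hbs.eq]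
  have key' : s * (t + b) = u * e := by
    rw [← key]
    exact (hct.add_right hbs.symm).eq
  refine ⟨↑u⁻¹ * s, ?_, ?_, ?_⟩
  · rw [← mul_assoc, ← ctb.eq, mul_assoc, key, Units.inv_mul_cancel_left]
  · rw [mul_assoc, key', Units.inv_mul_cancel_left]
  · rw [← mul_assoc, ← (ce.units_inv_left).eq, mul_assoc, hes]

/-- `P ⊗ 1` maps the cycles of the Koszul complex to boundaries, in every degree. -/
def KillsHomology (θ : L →ₗ[ℂ] X →L[ℂ] X) (P : Module.End ℂ X) : Prop :=
  ∀ (p : ℕ) (z : X ⊗[ℂ] ⋀[ℂ]^p L), diff θ p z = 0 →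
    P.rTensor _ z ∈ LinearMap.range (diff θ (p + 1))

/-- If some `θ(l)` is invertible on a `θ`-invariant direct summand of `X`, with equivariant
projection `e`, then the summand does not contribute to the homology: the operator
`θ(l) ⊗ 1 + 1 ⊗ ad l` is invertible on the corresponding subcomplex, and null-homotopic. -/
theorem killsHomology_of_inverse [LieRing.IsNilpotent L] {θ : L →ₗ[ℂ] X →L[ℂ] X} (hθ : IsRep θ)
    (l : L) {e s : Module.End ℂ X} (he : ∀ m x, e (θ m x) = θ m (e x))
    (hts : ∀ x, θ l (s x) = e x) (hst : ∀ x, s (θ l x) = e x) (hes : ∀ x, e (s x) = s x) :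
    KillsHomology θ e := by
  have hg : ∀ p : ℕ, ∃ g : Module.End ℂ (X ⊗[ℂ] ⋀[ℂ]^p L),
      lieDeriv θ l p * g = e.rTensor _ ∧ g * lieDeriv θ l p = e.rTensor _ ∧
        e.rTensor _ * g = g := by
    intro p
    refine exists_inverse_add_of_isNilpotent (s := s.rTensor _) ?_ ?_ ?_ ?_ ?_ ?_
    · ext; simp [hts]
    · ext; simp [hst]
    · ext; simp [hes]
    · ext; simp
    · ext; simp
    · obtain ⟨k, hk⟩ := isNilpotent_adExt l p
      exact ⟨k, by rw [LinearMap.lTensor_pow, hk, LinearMap.lTensor_zero]⟩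
  intro p z hz
  obtain ⟨g, hg1, -, hg3⟩ := hg p
  have hg1 := LinearMap.congr_fun hg1 z
  rw [Module.End.mul_apply] at hg1
  cases p with
  | zero => exact ⟨insertion X l 0 (g z), by rw [diff_insertion_zero, hg1]⟩
  | succ p =>
    obtain ⟨g', -, hg2, -⟩ := hg p
    refine ⟨insertion X l (p + 1) (g z), ?_⟩
    have h1 : lieDeriv θ l p (diff θ (p + 1) (g z)) = 0 := by
      rw [← diff_lieDeriv hθ, hg1, diff_rTensor he, hz, map_zero]
    -- `g z` lies in the subcomplex where the action of `l` is injective, and that action kills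
    -- `d (g z)`.
    have h2 : e.rTensor _ (diff θ (p + 1) (g z)) = diff θ (p + 1) (g z) := by
      rw [← diff_rTensor he, ← Module.End.mul_apply, hg3]
    have h3 : diff θ (p + 1) (g z) = 0 := by
      rw [← h2]
      exact (LinearMap.congr_fun hg2 _).symm.trans (by rw [Module.End.mul_apply, h1, map_zero])
    rw [diff_insertion, h3, map_zero, sub_zero, hg1]

end Complex

/-! ### Fitting decomposition of Lie modules -/

section Fitting

theorem ker_pow_add_eq {M : Type*} [AddCommGroup M] [Module ℂ M] {T : Module.End ℂ M} {m : ℕ}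
    (hk : LinearMap.ker (T ^ m) = LinearMap.ker (T ^ (m + 1))) (k : ℕ) :
    LinearMap.ker (T ^ (m + k)) = LinearMap.ker (T ^ m) := by
  exact (Module.End.ker_pow_constant hk k).symm

theorem range_pow_add_eq {M : Type*} [AddCommGroup M] [Module ℂ M] {T : Module.End ℂ M} {m : ℕ}
    (hr : LinearMap.range (T ^ m) = LinearMap.range (T ^ (m + 1))) (k : ℕ) :
    LinearMap.range (T ^ (m + k)) = LinearMap.range (T ^ m) := by
  induction k with
  | zero => rfl
  | succ k ih =>
    rw [← add_assoc, pow_succ', Module.End.mul_eq_comp, LinearMap.range_comp, ih,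
      ← LinearMap.range_comp, ← Module.End.mul_eq_comp, ← pow_succ', hr]

/-- Fitting decomposition of an operator of finite ascent and descent. -/
theorem isCompl_range_pow_ker_pow {M : Type*} [AddCommGroup M] [Module ℂ M] {T : Module.End ℂ M}
    {m : ℕ} (hk : LinearMap.ker (T ^ m) = LinearMap.ker (T ^ (m + 1)))
    (hr : LinearMap.range (T ^ m) = LinearMap.range (T ^ (m + 1))) :
    IsCompl (LinearMap.range (T ^ m)) (LinearMap.ker (T ^ m)) := by
  constructor
  · rw [Submodule.disjoint_def]
    rintro _ ⟨y, rfl⟩ hy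
    have : y ∈ LinearMap.ker (T ^ (m + m)) := by
      rwa [LinearMap.mem_ker, pow_add, Module.End.mul_apply]
    rwa [ker_pow_add_eq hk, LinearMap.mem_ker] at this
  · rw [codisjoint_iff, eq_top_iff]
    intro x _
    have : (T ^ m) x ∈ LinearMap.range (T ^ (m + m)) := by
      rw [range_pow_add_eq hr]; exact ⟨x, rfl⟩
    obtain ⟨y, hy⟩ := this
    refine Submodule.mem_sup.mpr ⟨(T ^ m) y, ⟨y, rfl⟩, x - (T ^ m) y, ?_, by abel⟩
    rw [LinearMap.mem_ker, map_sub, ← Module.End.mul_apply, ← pow_add, hy, sub_self]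

/-- An operator is invertible on the range part of its Fitting decomposition. -/
theorem exists_inverse_on_range_pow {M : Type*} [AddCommGroup M] [Module ℂ M] {T : Module.End ℂ M}
    {m : ℕ} (hk : LinearMap.ker (T ^ m) = LinearMap.ker (T ^ (m + 1)))
    (hr : LinearMap.range (T ^ m) = LinearMap.range (T ^ (m + 1)))
    (h : IsCompl (LinearMap.range (T ^ m)) (LinearMap.ker (T ^ m))) :
    ∃ s : Module.End ℂ M, (∀ x, T (s x) = Submodule.projection _ _ h x) ∧
      (∀ x, s (T x) = Submodule.projection _ _ h x) ∧
      ∀ x, Submodule.projection _ _ h (s x) = s x := by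
  set R := LinearMap.range (T ^ m)
  have hTR : ∀ x ∈ R, T x ∈ R := by
    rintro _ ⟨y, rfl⟩
    exact ⟨T y, by rw [← Module.End.mul_apply, ← Module.End.mul_apply, ← pow_succ, ← pow_succ']⟩
  have hTN : ∀ x ∈ LinearMap.ker (T ^ m), T x ∈ LinearMap.ker (T ^ m) := by
    intro x hx
    rw [LinearMap.mem_ker] at hx ⊢
    rw [← Module.End.mul_apply, ← pow_succ, pow_succ', Module.End.mul_apply, hx, map_zero]
  have hbij : Function.Bijective (T.restrict hTR) := by
    constructor
    · rw [← LinearMap.ker_eq_bot, LinearMap.ker_eq_bot']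
      rintro ⟨_, y, rfl⟩ hy
      have hy' : T ((T ^ m) y) = 0 := congrArg Subtype.val hy
      have : y ∈ LinearMap.ker (T ^ (m + 1)) := by
        rwa [LinearMap.mem_ker, pow_succ', Module.End.mul_apply]
      rw [← hk, LinearMap.mem_ker] at this
      exact Subtype.ext this
    · rintro ⟨x, hx⟩
      have hx' := hx
      rw [show R = _ from hr] at hx'
      obtain ⟨y, hy⟩ := hx'
      refine ⟨⟨(T ^ m) y, y, rfl⟩, Subtype.ext ?_⟩
      rwa [pow_succ', Module.End.mul_apply] at hy
  let u := LinearEquiv.ofBijective _ hbij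
  have hu : ∀ r : R, T (u.symm r) = r := fun r => congrArg Subtype.val (u.apply_symm_apply r)
  refine ⟨R.subtype ∘ₗ u.symm.toLinearMap ∘ₗ Submodule.projectionOnto _ _ h, fun x => ?_,
    fun x => ?_, fun x => ?_⟩
  · exact hu _
  · have hTx : Submodule.projectionOnto _ _ h (T x) = u (Submodule.projectionOnto _ _ h x) := by
      have hx : T x = T (Submodule.projectionOnto _ _ h x) +
          T (x - Submodule.projectionOnto _ _ h x) := by rw [← map_add]; congr 1; abel
      have h2 : T (x - Submodule.projectionOnto _ _ h x) ∈ LinearMap.ker (T ^ m) := by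
        refine hTN _ ((Submodule.projectionOnto_apply_eq_zero_iff h).mp ?_)
        rw [map_sub, Submodule.projectionOnto_apply_left, sub_self]
      rw [hx, map_add, (Submodule.projectionOnto_apply_eq_zero_iff h).mpr h2, add_zero]
      exact Submodule.projectionOnto_apply_left h (u (Submodule.projectionOnto _ _ h x))
    simp only [LinearMap.comp_apply, hTx, LinearEquiv.coe_coe, LinearEquiv.symm_apply_apply]
    rfl
  · simp [← Submodule.coe_projectionOnto_apply]

variable {L : Type*} [LieRing L] {M : Type*} [AddCommGroup M] [Module ℂ M] [LieRingModule L M]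

theorem projection_lie {N R : LieSubmodule ℂ L M} (h : IsCompl N.toSubmodule R.toSubmodule)
    (l : L) (x : M) :
    Submodule.projection _ _ h ⁅l, x⁆ = ⁅l, Submodule.projection _ _ h x⁆ := by
  set y := Submodule.projectionOnto _ _ h x with hy
  have h1 : ⁅l, (y : M)⁆ ∈ N.toSubmodule := N.lie_mem y.2
  have h2 : ⁅l, x - y⁆ ∈ R.toSubmodule := by
    refine R.lie_mem ((Submodule.projectionOnto_apply_eq_zero_iff h).mp ?_)
    rw [map_sub, ← hy, Submodule.projectionOnto_apply_left, sub_self]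
  have hx : ⁅l, x⁆ = ⁅l, (y : M)⁆ + ⁅l, x - y⁆ := by rw [← lie_add]; congr 1; abel
  rw [← Submodule.coe_projectionOnto_apply, ← Submodule.coe_projectionOnto_apply, hx, map_add,
    Submodule.projectionOnto_apply_of_mem_right h h2, add_zero,
    Submodule.projectionOnto_apply_of_mem_left h h1]

variable [LieAlgebra ℂ L] [LieModule ℂ L M] [LieRing.IsNilpotent L]

theorem genWeightSpaceOf_eq_ker_pow {l : L} {m : ℕ}
    (hk : LinearMap.ker (LieModule.toEnd ℂ L M l ^ m) =
      LinearMap.ker (LieModule.toEnd ℂ L M l ^ (m + 1))) :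
    (LieModule.genWeightSpaceOf M (0 : ℂ) l).toSubmodule =
      LinearMap.ker (LieModule.toEnd ℂ L M l ^ m) := by
  rw [LieModule.coe_genWeightSpaceOf_zero]
  refine le_antisymm (iSup_le fun k => ?_) (le_iSup (fun k => LinearMap.ker (_ ^ k)) m)
  rw [← ker_pow_add_eq hk k, add_comm]
  intro x hx
  rw [LinearMap.mem_ker] at hx ⊢
  rw [add_comm, pow_add, Module.End.mul_apply, hx, map_zero]

theorem posFittingCompOf_eq_range_pow {l : L} {m : ℕ}
    (hr : LinearMap.range (LieModule.toEnd ℂ L M l ^ m) =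
      LinearMap.range (LieModule.toEnd ℂ L M l ^ (m + 1))) :
    (LieModule.posFittingCompOf ℂ M l).toSubmodule =
      LinearMap.range (LieModule.toEnd ℂ L M l ^ m) := by
  refine le_antisymm (iInf_le (fun k => LinearMap.range (_ ^ k)) m) (le_iInf fun k => ?_)
  rw [← range_pow_add_eq hr k, add_comm, pow_add, Module.End.mul_eq_comp]
  exact LinearMap.range_comp_le_range _ _

/-- Fitting decomposition of a Lie module with respect to one operator of finite ascent and
descent: equivariant retraction onto the generalized null space, and inverse of the operator on
the complement. -/
theorem exists_fitting {l : L} {m : ℕ}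
    (hk : LinearMap.ker (LieModule.toEnd ℂ L M l ^ m) =
      LinearMap.ker (LieModule.toEnd ℂ L M l ^ (m + 1)))
    (hr : LinearMap.range (LieModule.toEnd ℂ L M l ^ m) =
      LinearMap.range (LieModule.toEnd ℂ L M l ^ (m + 1))) :
    ∃ (r : M →ₗ[ℂ] LieModule.genWeightSpaceOf M (0 : ℂ) l) (e s : Module.End ℂ M),
      (∀ (a : L) (x : M), r ⁅a, x⁆ = ⁅a, r x⁆) ∧
      (∀ x : LieModule.genWeightSpaceOf M (0 : ℂ) l, r x = x) ∧
      (∀ (a : L) (x : M), e ⁅a, x⁆ = ⁅a, e x⁆) ∧ (∀ x, (r x : M) + e x = x) ∧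
      (∀ x, ⁅l, s x⁆ = e x) ∧ (∀ x : M, s ⁅l, x⁆ = e x) ∧ ∀ x, e (s x) = s x := by
  have hN := genWeightSpaceOf_eq_ker_pow hk
  have hR := posFittingCompOf_eq_range_pow hr
  have hc := isCompl_range_pow_ker_pow hk hr
  obtain ⟨s, h1, h2, h3⟩ := exists_inverse_on_range_pow hk hr hc
  have hc' : IsCompl (LieModule.posFittingCompOf ℂ M l).toSubmodule
      (LieModule.genWeightSpaceOf M (0 : ℂ) l).toSubmodule := by rwa [hN, hR]
  have he : Submodule.projection _ _ hc = Submodule.projection _ _ hc' := by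
    congr 1 <;> simp [hN, hR]
  rw [he] at h1 h2 h3
  refine ⟨Submodule.projectionOnto _ _ hc'.symm, Submodule.projection _ _ hc', s,
    fun a x => Subtype.ext (projection_lie hc'.symm a x),
    Submodule.projectionOnto_apply_left hc'.symm, projection_lie hc', fun x => ?_, h1, h2, h3⟩
  · rw [Submodule.coe_projectionOnto_apply, add_comm]
    exact Submodule.projection_add_projection_eq_self hc' x

end Fitting

/-! ### Summands that do not contribute to the homology -/

section Homology

variable {X : Type*} [NormedAddCommGroup X] [NormedSpace ℂ X]
  {L : Type*} [LieRing L] [LieAlgebra ℂ L]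

theorem KillsHomology.add {θ : L →ₗ[ℂ] X →L[ℂ] X} {P Q : Module.End ℂ X}
    (hP : KillsHomology θ P) (hQ : KillsHomology θ Q) : KillsHomology θ (P + Q) := by
  intro p z hz
  rw [LinearMap.rTensor_add, LinearMap.add_apply]
  exact add_mem (hP p z hz) (hQ p z hz)

/-- A finite-dimensional equivariant retract of `X` without nonzero invariants does not contribute
to the homology. By induction on the dimension: split off, by Fitting, a summand on which some
`l` acts invertibly. -/
theorem killsHomology_of_finiteDimensional [LieRing.IsNilpotent L] {θ : L →ₗ[ℂ] X →L[ℂ] X}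
    (hθ : IsRep θ) {S : Type*} [AddCommGroup S] [Module ℂ S] [LieRingModule L S] [LieModule ℂ L S]
    [FiniteDimensional ℂ S] (ι : S →ₗ[ℂ] X) (r : X →ₗ[ℂ] S)
    (hι : ∀ l x, ι ⁅l, x⁆ = θ l (ι x)) (hr : ∀ l x, r (θ l x) = ⁅l, r x⁆) (hrι : ∀ x, r (ι x) = x)
    (hS : ∀ x : S, (∀ l : L, ⁅l, x⁆ = 0) → x = 0) : KillsHomology θ (ι ∘ₗ r) := by
  induction hn : Module.finrank ℂ S using Nat.strong_induction_on generalizing S with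
  | _ n ih =>
  by_cases hnil : ∀ l, IsNilpotent (LieModule.toEnd ℂ L S l)
  · -- By Engel's theorem `S` has invariants unless it is zero.
    have := LieModule.isNilpotent_iff_forall'.mpr hnil
    have hsub : Subsingleton S := by
      by_contra hcon
      rw [not_subsingleton_iff_nontrivial] at hcon
      have := LieModule.nontrivial_max_triv_of_isNilpotent ℂ L S
      obtain ⟨⟨x, hx⟩, hx0⟩ := exists_ne (0 : LieModule.maxTrivSubmodule ℂ L S)
      exact hx0 (Subtype.ext (hS x ((LieModule.mem_maxTrivSubmodule ℂ L S x).mp hx)))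
    have h0 : ι ∘ₗ r = 0 := LinearMap.ext fun x => by
      rw [LinearMap.comp_apply, Subsingleton.elim (r x) 0, map_zero, LinearMap.zero_apply]
    intro p z _
    rw [h0, LinearMap.rTensor_zero, LinearMap.zero_apply]
    exact zero_mem _
  · push Not at hnil
    obtain ⟨l, hl⟩ := hnil
    obtain ⟨m, hk, hr'⟩ : ∃ m, LinearMap.ker (LieModule.toEnd ℂ L S l ^ m) =
        LinearMap.ker (LieModule.toEnd ℂ L S l ^ (m + 1)) ∧
        LinearMap.range (LieModule.toEnd ℂ L S l ^ m) =
        LinearMap.range (LieModule.toEnd ℂ L S l ^ (m + 1)) := by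
      obtain ⟨m, hm⟩ := Filter.eventually_atTop.mp
        ((LieModule.toEnd ℂ L S l).eventually_iSup_ker_pow_eq.and
          (LieModule.toEnd ℂ L S l).eventually_iInf_range_pow_eq)
      have h1 := hm m le_rfl
      have h2 := hm (m + 1) (by omega)
      exact ⟨m, h1.1.symm.trans h2.1, h1.2.symm.trans h2.2⟩
    obtain ⟨q, e, s, hq, hqi, he, hqe, h1, h2, h3⟩ := exists_fitting hk hr'
    have hlt : Module.finrank ℂ (LieModule.genWeightSpaceOf S (0 : ℂ) l) < n := by
      rw [← hn]
      refine Submodule.finrank_lt (s := (LieModule.genWeightSpaceOf S (0 : ℂ) l).toSubmodule) ?_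
      rw [genWeightSpaceOf_eq_ker_pow hk, Ne, LinearMap.ker_eq_top]
      exact fun h => hl ⟨m, h⟩
    have hA := ih _ hlt (ι ∘ₗ (LieModule.genWeightSpaceOf S (0 : ℂ) l).incl.toLinearMap)
      (q ∘ₗ r)
      (fun a x => hι a x) (fun a x => (congrArg q (hr a x)).trans (hq a (r x)))
      (fun x => (congrArg q (hrι x)).trans (hqi x))
      (fun x hx => Subtype.ext (hS x fun a => by simpa using congrArg Subtype.val (hx a))) rfl
    have hB : KillsHomology θ (ι ∘ₗ e ∘ₗ r) := by
      refine killsHomology_of_inverse hθ l (s := ι ∘ₗ s ∘ₗ r) ?_ ?_ ?_ ?_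
      · simp [hr, he, hι]
      · simp [← hι, h1]
      · simp [hr, h2]
      · simp [hrι, h3]
    have hAB := hA.add hB
    have : ι ∘ₗ r = (ι ∘ₗ (LieModule.genWeightSpaceOf S (0 : ℂ) l).incl.toLinearMap) ∘ₗ q ∘ₗ r +
        ι ∘ₗ e ∘ₗ r := by
      ext x
      exact (congrArg ι (hqe (r x)).symm).trans (map_add ι _ _)
    rwa [this]

/-- A linear map that kills all `θ(l) x` vanishes if `d₁` is surjective. -/
theorem eq_zero_of_range_diff_one_eq_top {θ : L →ₗ[ℂ] X →L[ℂ] X}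
    (h : LinearMap.range (diff θ 1) = ⊤) {W : Type*} [AddCommGroup W] [Module ℂ W]
    (φ : X →ₗ[ℂ] W) (hφ : ∀ l x, φ (θ l x) = 0) : φ = 0 := by
  have h0 : φ.rTensor (⋀[ℂ]^0 L) ∘ₗ diff θ 1 = 0 := by
    refine hom_ext_insertion fun l z => ?_
    rw [LinearMap.comp_apply, diff_insertion_zero, LinearMap.zero_apply]
    have : φ.rTensor (⋀[ℂ]^0 L) ∘ₗ lieDeriv θ l 0 = 0 := by
      refine TensorProduct.ext' fun x w => ?_
      simp [lieDeriv, adExt, hφ]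
    exact LinearMap.congr_fun this z
  ext x
  obtain ⟨z, hz⟩ : x ⊗ₜ[ℂ] ((exteriorPower.zeroEquiv ℂ L).symm 1) ∈ LinearMap.range (diff θ 1) := by
    rw [h]; trivial
  have h1 := LinearMap.congr_fun h0 z
  rw [LinearMap.comp_apply, hz, LinearMap.rTensor_tmul, LinearMap.zero_apply] at h1
  have h2 := congrArg (TensorProduct.rid ℂ W ∘ (exteriorPower.zeroEquiv ℂ L).lTensor W) h1
  simpa using h2

end Homology

/-! ### Riesz theory of compact operators -/

section Riesz

variable {X : Type*} [NormedAddCommGroup X] [NormedSpace ℂ X]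

theorem finiteDimensional_ker_sub_smul {T : X →L[ℂ] X} (hT : IsCompactOperator T) {μ : ℂ}
    (hμ : μ ≠ 0) : FiniteDimensional ℂ (LinearMap.ker (T - μ • 1 : X →L[ℂ] X).toLinearMap) := by
  set V := LinearMap.ker (T - μ • 1 : X →L[ℂ] X).toLinearMap
  have hV : ∀ v ∈ V, T v = μ • v := fun v hv => by
    have : T v - μ • v = 0 := by simpa [V] using hv
    exact sub_eq_zero.mp this
  have hV' : ∀ v ∈ V, T.toLinearMap v ∈ V := fun v hv => by
    rw [ContinuousLinearMap.coe_coe, hV v hv]; exact V.smul_mem _ hv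
  have h1 : IsCompactOperator (T.toLinearMap.restrict hV') :=
    IsCompactOperator.restrict (f := T.toLinearMap) hT hV'
      (ContinuousLinearMap.isClosed_ker (T - μ • 1 : X →L[ℂ] X))
  have h2 : IsCompactOperator (μ⁻¹ • ⇑(T.toLinearMap.restrict hV')) := h1.smul _
  refine FiniteDimensional.of_isCompactOperator_id (𝕜 := ℂ) ?_
  have h3 : μ⁻¹ • ⇑(T.toLinearMap.restrict hV') = id := funext fun v => Subtype.ext <| by
    have : T v = μ • v := hV v v.2
    simp [this, hμ]
  rwa [h3] at h2

theorem finiteDimensional_ker_sub_smul_pow {T : X →L[ℂ] X} (hT : IsCompactOperator T) {μ : ℂ}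
    (hμ : μ ≠ 0) (k : ℕ) :
    FiniteDimensional ℂ (LinearMap.ker ((T - μ • 1 : X →L[ℂ] X).toLinearMap ^ k)) := by
  have h1 := finiteDimensional_ker_sub_smul hT hμ
  set S := (T - μ • 1 : X →L[ℂ] X).toLinearMap
  induction k with
  | zero =>
    rw [pow_zero, show LinearMap.ker (1 : Module.End ℂ X) = ⊥ from LinearMap.ker_id]
    infer_instance
  | succ k ih =>
    refine Module.Finite.iff_fg.mpr ?_
    replace h1 := Module.Finite.iff_fg.mp h1
    replace ih := Module.Finite.iff_fg.mp ih
    refine Submodule.fg_of_fg_map_of_fg_inf_ker S ?_ ?_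
    · have : Submodule.map S (LinearMap.ker (S ^ (k + 1))) ≤ LinearMap.ker (S ^ k) := by
        rintro _ ⟨x, hx, rfl⟩
        rwa [LinearMap.mem_ker, ← Module.End.mul_apply, ← pow_succ]
      exact Submodule.FG.of_le ih this
    · exact Submodule.FG.of_le h1 inf_le_right

/-- A nonzero scalar perturbation of a compact operator has finite ascent (Riesz). -/
theorem exists_ker_sub_smul_pow_eq {T : X →L[ℂ] X} (hT : IsCompactOperator T) {μ : ℂ}
    (hμ : μ ≠ 0) :
    ∃ m, LinearMap.ker ((T - μ • 1 : X →L[ℂ] X).toLinearMap ^ m) =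
      LinearMap.ker ((T - μ • 1 : X →L[ℂ] X).toLinearMap ^ (m + 1)) := by
  have hfin := finiteDimensional_ker_sub_smul_pow hT hμ
  set S := (T - μ • 1 : X →L[ℂ] X).toLinearMap with hS
  by_contra! hne
  set V : ℕ → Submodule ℂ X := fun n => LinearMap.ker (S ^ n) with hVdef
  have hmono : Monotone V := monotone_nat_of_le_succ fun n x hx => by
    simp only [hVdef, LinearMap.mem_ker] at hx ⊢
    rw [pow_succ', Module.End.mul_apply, hx, map_zero]
  have hSV : ∀ n, ∀ x ∈ V (n + 1), S x ∈ V n := fun n x hx => by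
    simp only [hVdef, LinearMap.mem_ker] at hx ⊢
    rwa [← Module.End.mul_apply, ← pow_succ]
  have hTS : ∀ x, T x = S x + μ • x := fun x => by simp [hS]
  obtain ⟨c, hc⟩ := NormedField.exists_one_lt_norm ℂ
  -- Riesz's lemma gives bounded vectors in `ker S ^ (n + 1)` at distance `≥ 1` from `ker S ^ n`.
  have hx : ∀ n, ∃ x ∈ V (n + 1), ‖x‖ ≤ ‖c‖ + 1 ∧ ∀ y ∈ V n, 1 ≤ ‖x - y‖ := by
    intro n
    have hcl : IsClosed ((V n).comap (V (n + 1)).subtype : Set (V (n + 1))) :=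
      ((V n).closed_of_finiteDimensional).preimage continuous_subtype_val
    obtain ⟨x, hx, hxn⟩ := SetLike.exists_of_lt (lt_of_le_of_ne (hmono n.le_succ) (hne n))
    obtain ⟨⟨x, hx⟩, hxn, hxy⟩ := riesz_lemma_of_norm_lt hc (lt_add_one ‖c‖) hcl ⟨⟨x, hx⟩, hxn⟩
    exact ⟨x, hx, hxn, fun y hy => hxy ⟨y, hmono n.le_succ hy⟩ hy⟩
  choose x hxV hxR hxd using hx
  have hfar : ∀ m n, m < n → ‖μ‖ ≤ ‖T (x n) - T (x m)‖ := by
    intro m n hmn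
    have hmem : x m ∈ V n := hmono hmn (hxV m)
    have hu : μ⁻¹ • (T (x m) - S (x n)) ∈ V n := by
      refine (V n).smul_mem _ ((V n).sub_mem ?_ (hSV n _ (hxV n)))
      rw [hTS]
      exact (V n).add_mem (hSV n _ (hmono n.le_succ hmem)) ((V n).smul_mem _ hmem)
    have h1 := hxd n _ hu
    have h2 : T (x n) - T (x m) = μ • (x n - μ⁻¹ • (T (x m) - S (x n))) := by
      rw [smul_sub, smul_inv_smul₀ hμ, hTS (x n)]; abel
    rw [h2, norm_smul]
    exact le_mul_of_one_le_right (norm_nonneg _) h1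
  obtain ⟨K, hK, hK'⟩ := hT.image_closedBall_subset_compact (‖c‖ + 1)
  obtain ⟨y, -, ψ, hψ, hψy⟩ := hK.tendsto_subseq (fun n ↦ hK' ⟨x n, by simp [hxR], rfl⟩)
  obtain ⟨N, hN⟩ := Metric.cauchySeq_iff'.mp hψy.cauchySeq ‖μ‖ (norm_pos_iff.mpr hμ)
  have h1 := hN (N + 1) (Nat.le_succ N)
  rw [Function.comp_apply, Function.comp_apply, dist_eq_norm] at h1
  exact h1.not_ge (hfar _ _ (hψ N.lt_succ_self))

/-- Riesz theory: a nonzero scalar perturbation of a compact operator has finite ascent and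
descent, with finite-dimensional generalized null space. For the descent, the Fredholm
alternative is applied to the operator induced modulo the generalized null space. -/
theorem exists_riesz_decomposition [CompleteSpace X] {T : X →L[ℂ] X} (hT : IsCompactOperator T)
    {μ : ℂ} (hμ : μ ≠ 0) :
    ∃ m, FiniteDimensional ℂ (LinearMap.ker ((T - μ • 1 : X →L[ℂ] X).toLinearMap ^ m)) ∧
      LinearMap.ker ((T - μ • 1 : X →L[ℂ] X).toLinearMap ^ m) =
        LinearMap.ker ((T - μ • 1 : X →L[ℂ] X).toLinearMap ^ (m + 1)) ∧
      LinearMap.range ((T - μ • 1 : X →L[ℂ] X).toLinearMap ^ m) =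
        LinearMap.range ((T - μ • 1 : X →L[ℂ] X).toLinearMap ^ (m + 1)) := by
  obtain ⟨m, hm⟩ := exists_ker_sub_smul_pow_eq hT hμ
  have hfin := finiteDimensional_ker_sub_smul_pow hT hμ m
  refine ⟨m, hfin, hm, ?_⟩
  set S := (T - μ • 1 : X →L[ℂ] X).toLinearMap with hS
  set N := LinearMap.ker (S ^ m) with hN
  have hTS : ∀ x, T x = S x + μ • x := fun x => by simp [hS]
  have hTN : ∀ x ∈ N, T x ∈ N := fun x hx => by
    rw [hTS]
    refine N.add_mem ?_ (N.smul_mem _ hx)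
    rw [hN, LinearMap.mem_ker] at hx ⊢
    rw [← Module.End.mul_apply, ← pow_succ, pow_succ', Module.End.mul_apply, hx, map_zero]
  have hcl : IsClosed (N : Set X) := N.closed_of_finiteDimensional
  let Tq : (X ⧸ N) →L[ℂ] (X ⧸ N) := N.liftQL (N.mkQL ∘L T) fun x hx => by
    simpa using hTN x hx
  have hTq : ∀ x, Tq (N.mkQL x) = N.mkQL (T x) := fun x => rfl
  have hcomp : IsCompactOperator Tq := by
    obtain ⟨K, hK, hK'⟩ := hT
    refine ⟨N.mkQL '' K, hK.image N.mkQL.continuous, ?_⟩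
    have h1 := N.isOpenQuotientMap_mkQL.isOpenMap.image_mem_nhds hK'
    rw [map_zero] at h1
    refine Filter.mem_of_superset h1 ?_
    rintro _ ⟨x, hx, rfl⟩
    exact ⟨T x, hx, (hTq x).symm⟩
  have hsurj : ∀ x, ∃ y, S y - x ∈ N := by
    rcases hcomp.hasEigenvalue_or_mem_resolventSet hμ with h | h
    · exfalso
      obtain ⟨v, hv⟩ := h.exists_hasEigenvector
      obtain ⟨x, rfl⟩ := N.mkQ_surjective v
      refine hv.2 ((Submodule.Quotient.mk_eq_zero N).mpr ?_)
      have h1 : N.mkQL (T x) = μ • N.mkQL x := hv.apply_eq_smul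
      have h2 : S x ∈ N := by
        rw [← Submodule.Quotient.mk_eq_zero N]
        have h3 : N.mkQL (S x) = 0 := by
          rw [show S x = T x - μ • x by rw [hTS]; abel, map_sub, map_smul, h1, sub_self]
        exact h3
      rwa [hN, LinearMap.mem_ker, ← Module.End.mul_apply, ← pow_succ, ← LinearMap.mem_ker,
        ← hm] at h2
    · rw [spectrum.mem_resolventSet_iff, ContinuousLinearMap.isUnit_iff_bijective] at h
      intro x
      obtain ⟨v, hv⟩ := h.2 (-N.mkQL x)
      obtain ⟨y, rfl⟩ := N.mkQ_surjective v
      refine ⟨y, (Submodule.Quotient.mk_eq_zero N).mp ?_⟩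
      have h1 : μ • N.mkQL y - Tq (N.mkQL y) = -N.mkQL x := by
        simpa [Algebra.algebraMap_eq_smul_one] using hv
      rw [hTq] at h1
      have h3 : N.mkQL (S y - x) = 0 := by
        rw [map_sub, show S y = T y - μ • y by rw [hTS]; abel, map_sub, map_smul,
          sub_eq_zero, ← neg_inj, ← h1, neg_sub]
      exact h3
  refine le_antisymm ?_ ?_
  · rintro _ ⟨x, rfl⟩
    obtain ⟨y, hy⟩ := hsurj x
    refine ⟨y, ?_⟩
    rw [hN, LinearMap.mem_ker, map_sub, sub_eq_zero] at hy
    rw [pow_succ, Module.End.mul_apply, hy]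
  · rw [pow_succ, Module.End.mul_eq_comp]
    exact LinearMap.range_comp_le_range _ _

end Riesz

/-! ### Closedness of the kernels -/

section Topology

variable {X : Type*} [NormedAddCommGroup X] [NormedSpace ℂ X]

theorem contract_tmul {V : Type*} [AddCommGroup V] [Module ℂ V] (φ : Module.Dual ℂ V) (x : X)
    (v : V) : contract X φ (x ⊗ₜ v) = φ v • x := by
  simp [contract]

theorem sum_contract_tmul {V : Type*} [AddCommGroup V] [Module ℂ V] {ι : Type*} [Fintype ι]
    (b : Module.Basis ι ℂ V) (z : X ⊗[ℂ] V) : ∑ i, contract X (b.coord i) z ⊗ₜ[ℂ] b i = z := by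
  induction z with
  | zero => simp
  | add y z hy hz => simp only [map_add, TensorProduct.add_tmul, Finset.sum_add_distrib, hy, hz]
  | tmul x v =>
    simp only [contract_tmul, TensorProduct.smul_tmul]
    rw [← TensorProduct.tmul_sum]
    congr 1
    exact b.sum_repr v

theorem eq_zero_of_contract_eq_zero {V : Type*} [AddCommGroup V] [Module ℂ V]
    [FiniteDimensional ℂ V] {z : X ⊗[ℂ] V} (h : ∀ φ, contract X φ z = 0) : z = 0 := by
  rw [← sum_contract_tmul (Module.finBasis ℂ V) z]
  simp [h]

theorem tmul_ne_zero {V : Type*} [AddCommGroup V] [Module ℂ V] {x : X} {v : V} (hx : x ≠ 0)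
    (hv : v ≠ 0) : x ⊗ₜ[ℂ] v ≠ 0 := by
  intro h
  refine hv ((Module.forall_dual_apply_eq_zero_iff ℂ v).mp fun φ => ?_)
  have h1 := contract_tmul φ x v
  rw [h, map_zero] at h1
  exact (smul_eq_zero.mp h1.symm).resolve_right hx

/-- A linear map out of `X ⊗ V` whose components on pure tensors are continuous in `X` has closed
kernel. -/
theorem isClosed_ker_of_continuous {V W : Type*} [AddCommGroup V] [Module ℂ V]
    [FiniteDimensional ℂ V] [AddCommGroup W] [Module ℂ W] [FiniteDimensional ℂ W]
    (A : X ⊗[ℂ] V →ₗ[ℂ] X ⊗[ℂ] W)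
    (hA : ∀ (φ : Module.Dual ℂ W) (v : V), Continuous fun x => contract X φ (A (x ⊗ₜ v))) :
    IsClosed[tensorTopology X V] (LinearMap.ker A : Set (X ⊗[ℂ] V)) := by
  let : TopologicalSpace (X ⊗[ℂ] V) := tensorTopology X V
  let b := Module.finBasis ℂ V
  have hc : ∀ ψ : Module.Dual ℂ V, Continuous (contract X ψ) := fun ψ =>
    continuous_iff_le_induced.mpr (iInf_le _ ψ)
  have hcont : ∀ φ, Continuous fun z => contract X φ (A z) := by
    intro φ
    have : (fun z => contract X φ (A z)) = fun z =>
        ∑ i, contract X φ (A (contract X (b.coord i) z ⊗ₜ b i)) := by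
      funext z
      rw [← map_sum, ← map_sum, sum_contract_tmul]
    rw [this]
    exact continuous_finsetSum _ fun i _ => (hA φ (b i)).comp (hc _)
  have : (LinearMap.ker A : Set (X ⊗[ℂ] V)) = ⋂ φ, {z | contract X φ (A z) = 0} := by
    ext z
    simp only [SetLike.mem_coe, LinearMap.mem_ker, Set.mem_iInter, Set.mem_ofPred_eq]
    exact ⟨fun h φ => by rw [h, map_zero], eq_zero_of_contract_eq_zero⟩
  rw [this]
  exact isClosed_iInter fun φ => isClosed_singleton.preimage (hcont φ)

variable {L : Type*} [LieRing L] [LieAlgebra ℂ L] [FiniteDimensional ℂ L]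

theorem isClosed_ker_diff (θ : L →ₗ[ℂ] X →L[ℂ] X) (p : ℕ) :
    IsClosed[tensorTopology X (⋀[ℂ]^p L)] (LinearMap.ker (diff θ p) : Set (X ⊗[ℂ] ⋀[ℂ]^p L)) := by
  cases p with
  | zero =>
    rw [show LinearMap.ker (diff θ 0) = ⊤ from LinearMap.ker_zero]
    exact @isClosed_univ _ (tensorTopology X (⋀[ℂ]^0 L))
  | succ p =>
    refine isClosed_ker_of_continuous _ fun φ w => ?_
    have hw : w ∈ Submodule.span ℂ (Set.range (exteriorPower.ιMulti ℂ (p + 1) (M := L))) := by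
      rw [exteriorPower.ιMulti_span]; trivial
    induction hw using Submodule.span_induction with
    | mem w hw =>
      obtain ⟨v, rfl⟩ := hw
      simp only [diff, LinearMap.add_apply, actionPart_tmul_ιMulti, LinearMap.lTensor_tmul, map_add,
        map_sum, map_zsmul, contract_tmul, Nat.add_one_sub_one]
      fun_prop
    | zero => simpa using continuous_const
    | add u v _ _ hu hv =>
      simp only [TensorProduct.tmul_add, map_add]
      exact hu.add hv
    | smul c u _ hu =>
      simp only [TensorProduct.tmul_smul, map_smul]
      exact hu.const_smul c

end Topology

/-! ### Exactness and non-exactness of the Koszul complex -/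

section Exactness

variable {X : Type*} [NormedAddCommGroup X] [NormedSpace ℂ X]
  {L : Type*} [LieRing L] [LieAlgebra ℂ L]

/-- `X` as a Lie module through `θ`. -/
@[reducible] def repLieRingModule {θ : L →ₗ[ℂ] X →L[ℂ] X} (hθ : IsRep θ) : LieRingModule L X where
  bracket l x := θ l x
  add_lie a b x := by simp
  lie_add a x y := by simp
  leibniz_lie a b x := by simp [hθ a b x]

theorem repLieModule {θ : L →ₗ[ℂ] X →L[ℂ] X} (hθ : IsRep θ) :
    @LieModule ℂ L X _ _ _ _ _ (repLieRingModule hθ) :=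
  let := repLieRingModule hθ
  { smul_lie := fun c l x => by
      change θ (c • l) x = c • θ l x
      simp
    lie_smul := fun c l x => by
      change θ l (c • x) = c • θ l x
      simp }

variable [CompleteSpace X] [LieRing.IsNilpotent L]

/-- If some `θ(l)` is a nonzero scalar perturbation of a compact operator and `X` has no
nonzero invariants, the Koszul complex is exact. -/
theorem ker_diff_le_range_diff {θ : L →ₗ[ℂ] X →L[ℂ] X} (hθ : IsRep θ) {l : L} {T : X →L[ℂ] X}
    {μ : ℂ} (hT : IsCompactOperator T) (hμ : μ ≠ 0) (hl : θ l = T - μ • 1)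
    (hinv : ∀ x, (∀ a, θ a x = 0) → x = 0) (p : ℕ) :
    LinearMap.ker (diff θ p) ≤ LinearMap.range (diff θ (p + 1)) := by
  obtain ⟨m, hfin, hk, hr⟩ := exists_riesz_decomposition hT hμ
  let := repLieRingModule hθ
  have := repLieModule hθ
  have htoEnd : LieModule.toEnd ℂ L X l = (T - μ • 1 : X →L[ℂ] X).toLinearMap := by
    rw [← hl]; rfl
  rw [← htoEnd] at hfin hk hr
  rw [← genWeightSpaceOf_eq_ker_pow hk] at hfin
  have hfin' : FiniteDimensional ℂ (LieModule.genWeightSpaceOf X (0 : ℂ) l) := hfin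
  obtain ⟨r, e, s, hrl, hri, he, hre, h1, h2, h3⟩ := exists_fitting hk hr
  have hA := killsHomology_of_finiteDimensional hθ
    (LieModule.genWeightSpaceOf X (0 : ℂ) l).incl.toLinearMap r (fun _ _ => rfl) hrl hri
    (fun x hx => Subtype.ext (hinv x fun a => congrArg Subtype.val (hx a)))
  have hB := killsHomology_of_inverse hθ l he h1 h2 h3
  have h : (LieModule.genWeightSpaceOf X (0 : ℂ) l).incl.toLinearMap ∘ₗ r + e = LinearMap.id :=
    LinearMap.ext hre
  intro z hz
  have := (hA.add hB) p z hz
  rwa [h, LinearMap.rTensor_id] at this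

/-- If some `θ(l)` is a nonzero scalar perturbation of a compact operator and `X` has a nonzero
invariant vector, then `H₀ ≠ 0`: the generalized null space `N` of `θ(l)` is a finite-dimensional
equivariant quotient of `X`, and its zero weight space is not contained in `L · N`. -/
theorem range_diff_one_ne_top_of_invariant {θ : L →ₗ[ℂ] X →L[ℂ] X} (hθ : IsRep θ) {l : L}
    {T : X →L[ℂ] X} {μ : ℂ} (hT : IsCompactOperator T) (hμ : μ ≠ 0) (hl : θ l = T - μ • 1)
    {x : X} (hx0 : x ≠ 0) (hx : ∀ a, θ a x = 0) : LinearMap.range (diff θ 1) ≠ ⊤ := by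
  intro htop
  obtain ⟨m, hfin, hk, hr⟩ := exists_riesz_decomposition hT hμ
  let := repLieRingModule hθ
  have := repLieModule hθ
  have htoEnd : LieModule.toEnd ℂ L X l = (T - μ • 1 : X →L[ℂ] X).toLinearMap := by
    rw [← hl]; rfl
  rw [← htoEnd] at hfin hk hr
  rw [← genWeightSpaceOf_eq_ker_pow hk] at hfin
  have hfit := exists_fitting hk hr
  generalize hN : LieModule.genWeightSpaceOf X (0 : ℂ) l = N at hfin hfit
  obtain ⟨r, e, s, hrl, hri, -⟩ := hfit
  have hfin' : FiniteDimensional ℂ N := hfin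
  let N' : LieSubmodule ℂ L N := ⁅(⊤ : LieIdeal ℂ L), (⊤ : LieSubmodule ℂ L N)⁆
  have hN' : N' = ⊤ := by
    have h0 := eq_zero_of_range_diff_one_eq_top htop (N'.toSubmodule.mkQ ∘ₗ r) fun a y => by
      rw [LinearMap.comp_apply, show r (θ a y) = ⁅a, r y⁆ from hrl a y, Submodule.mkQ_apply,
        Submodule.Quotient.mk_eq_zero]
      exact LieSubmodule.lie_mem_lie (LieSubmodule.mem_top a) (LieSubmodule.mem_top _)
    rw [eq_top_iff]
    intro y _
    have h1 := LinearMap.congr_fun h0 (y : X)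
    rw [LinearMap.comp_apply, hri, LinearMap.zero_apply, Submodule.mkQ_apply,
      Submodule.Quotient.mk_eq_zero] at h1
    exact h1
  have hlcs : ∀ k, LieModule.lowerCentralSeries ℂ L N k = ⊤ := by
    intro k
    induction k with
    | zero => exact LieModule.lowerCentralSeries_zero ℂ L N
    | succ k ih => rw [LieModule.lowerCentralSeries_succ, ih]; exact hN'
  have hpos : LieModule.posFittingComp ℂ L N = ⊤ := by
    rw [← LieModule.iInf_lowerCentralSeries_eq_posFittingComp]
    simp [hlcs]
  have hc := LieModule.isCompl_genWeightSpace_zero_posFittingComp ℂ L N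
  rw [hpos] at hc
  have hxN : x ∈ N := by
    rw [← hN, LieModule.mem_genWeightSpaceOf]
    refine ⟨1, ?_⟩
    rw [pow_one, zero_smul, sub_zero]
    exact hx l
  have hx' : (⟨x, hxN⟩ : N) ∈ LieModule.genWeightSpace N (0 : L → ℂ) := by
    rw [LieModule.mem_genWeightSpace]
    intro a
    refine ⟨1, ?_⟩
    rw [pow_one, Pi.zero_apply, zero_smul, sub_zero]
    exact Subtype.ext (hx a)
  rw [disjoint_top.mp hc.disjoint, LieSubmodule.mem_bot] at hx'
  exact hx0 (congrArg Subtype.val hx')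

end Exactness

section Spectrum

variable {X : Type*} [NormedAddCommGroup X] [NormedSpace ℂ X]
  {L : Type*} [LieRing L] [LieAlgebra ℂ L]

/-- If `X` has infinite dimension and all `θ(l)` are compact, then `H₀ ≠ 0`: otherwise
`X^n → X`, `(xᵢ) ↦ ∑ θ(bᵢ) xᵢ` would be a compact surjection. -/
theorem range_diff_one_ne_top_of_compact [CompleteSpace X] [FiniteDimensional ℂ L]
    (hX : ¬ FiniteDimensional ℂ X) {θ : L →ₗ[ℂ] X →L[ℂ] X} (hθ : ∀ l, IsCompactOperator (θ l)) :
    LinearMap.range (diff θ 1) ≠ ⊤ := by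
  intro htop
  let b := Module.finBasis ℂ L
  let G : (Fin (Module.finrank ℂ L) → X) →L[ℂ] X :=
    ∑ i, θ (b i) ∘L ContinuousLinearMap.proj i
  have hG : ∀ y, G y = ∑ i, θ (b i) (y i) := fun y => by simp [G]
  have hGc : IsCompactOperator G :=
    Submodule.sum_mem (compactOperator (RingHom.id ℂ) (Fin (Module.finrank ℂ L) → X) X)
      fun i _ => (hθ (b i)).comp_clm
        (ContinuousLinearMap.proj (R := ℂ) (φ := fun _ : Fin (Module.finrank ℂ L) => X) i)
  have hsurj : Function.Surjective G := by
    have h0 := eq_zero_of_range_diff_one_eq_top htop (LinearMap.range G.toLinearMap).mkQ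
      fun l x => by
        rw [Submodule.mkQ_apply, Submodule.Quotient.mk_eq_zero]
        refine ⟨fun i => b.repr l i • x, ?_⟩
        rw [ContinuousLinearMap.coe_coe, hG]
        conv_rhs => rw [← b.sum_repr l, map_sum, sum_apply]
        simp
    rw [← ContinuousLinearMap.coe_coe, ← LinearMap.range_eq_top, eq_top_iff]
    intro x _
    have := LinearMap.congr_fun h0 x
    rwa [LinearMap.zero_apply, Submodule.mkQ_apply, Submodule.Quotient.mk_eq_zero] at this
  obtain ⟨K, hK, hK'⟩ := hGc
  refine hX (FiniteDimensional.of_isCompactOperator_id (𝕜 := ℂ) ⟨K, hK, ?_⟩)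
  have h1 := (G.isOpenMap hsurj).image_mem_nhds hK'
  rw [map_zero] at h1
  exact Filter.mem_of_superset h1 (Set.image_preimage_subset _ _)

/-- An invariant vector `x` gives the nonzero cycle `x ⊗ w` in top degree, which is no boundary since
`⋀^(n+1) L = 0`. It is a cycle because the bracket part of the differential vanishes on `⋀^n L`. -/
theorem exists_top_cycle [FiniteDimensional ℂ L] [LieRing.IsNilpotent L]
    (θ : L →ₗ[ℂ] X →L[ℂ] X) {x : X} (hx0 : x ≠ 0) (hx : ∀ a, θ a x = 0) {n : ℕ}
    (hn : n = Module.finrank ℂ L) :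
    ∃ z, diff θ n z = 0 ∧ z ∉ LinearMap.range (diff θ (n + 1)) := by
  have : Nontrivial (⋀[ℂ]^n L) := by
    refine Module.nontrivial_of_finrank_pos (R := ℂ) ?_
    rw [exteriorPower.finrank_eq, hn, Nat.choose_self]
    exact one_pos
  have : Subsingleton (⋀[ℂ]^(n + 1) L) := by
    rw [← Module.finrank_zero_iff (R := ℂ), exteriorPower.finrank_eq, hn,
      Nat.choose_eq_zero_of_lt (Nat.lt_succ_self _)]
  obtain ⟨w, hw⟩ := exists_ne (0 : ⋀[ℂ]^n L)
  refine ⟨x ⊗ₜ w, ?_, ?_⟩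
  · cases n with
    | zero => rfl
    | succ p =>
      have h1 : actionPart θ p ∘ₗ TensorProduct.mk ℂ X _ x = 0 := by
        refine exteriorPower.linearMap_ext (AlternatingMap.ext fun v => ?_)
        simp [actionPart_tmul_ιMulti, hx]
      have h2 := LinearMap.congr_fun h1 w
      simp only [LinearMap.comp_apply, TensorProduct.mk_apply, LinearMap.zero_apply] at h2
      simp only [diff, LinearMap.add_apply, h2, LinearMap.lTensor_tmul,
        bracketPart_top_eq_zero hn, LinearMap.zero_apply, TensorProduct.tmul_zero, add_zero]
  · rintro ⟨y, hy⟩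
    rw [Subsingleton.elim y 0, map_zero] at hy
    exact tmul_ne_zero hx0 hw hy.symm

theorem mem_sigma_iff (ρ : L →ₗ⁅ℂ⁆ X →L[ℂ] X) (p : ℕ)
    (f : Module.Dual ℂ L) :
    f ∈ sigma ρ p ↔ IsCharacter f ∧
      ¬ LinearMap.ker (diff (twist (ρ : L →ₗ[ℂ] X →L[ℂ] X) f) p) ≤
        LinearMap.range (diff (twist (ρ : L →ₗ[ℂ] X →L[ℂ] X) f) (p + 1)) := by
  rw [sigma, Set.mem_ofPred_eq, Submodule.Quotient.nontrivial_iff, Ne,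
    Submodule.submoduleOf_eq_top]

theorem twist_apply (ρ : L →ₗ⁅ℂ⁆ X →L[ℂ] X) (f : Module.Dual ℂ L)
    (l : L) (x : X) : twist (ρ : L →ₗ[ℂ] X →L[ℂ] X) f l x = ρ l x - f l • x := rfl

theorem isRep_twist (ρ : L →ₗ⁅ℂ⁆ X →L[ℂ] X) {f : Module.Dual ℂ L}
    (hf : IsCharacter f) : IsRep (twist (ρ : L →ₗ[ℂ] X →L[ℂ] X) f) := by
  intro a b x
  have h : ρ ⁅a, b⁆ x = ρ a (ρ b x) - ρ b (ρ a x) := by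
    rw [LieHom.map_lie, LieRing.of_associative_ring_bracket]; rfl
  simp only [twist_apply, h, hf a b, map_sub, map_smul]
  module

end Spectrum

end LieKoszul

end

theorem theorem1 {X : Type*} [NormedAddCommGroup X] [NormedSpace ℂ X] [CompleteSpace X]
    (hX : ¬ FiniteDimensional ℂ X)
    {L : Type*} [LieRing L] [LieAlgebra ℂ L] [FiniteDimensional ℂ L] [LieRing.IsNilpotent L]
    (ρ : L →ₗ⁅ℂ⁆ X →L[ℂ] X) (hρ : ∀ l : L, IsCompactOperator (ρ l)) :
    LieKoszul.taylorSpectrum ρ = {0} ∪ LieKoszul.eigenCharacters ρ ∧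
    ∀ k ≤ Module.finrank ℂ L,
      LieKoszul.deltaSpectrum ρ k ∪ {0} = {0} ∪ LieKoszul.eigenCharacters ρ ∧
      LieKoszul.piSpectrum ρ k ∪ {0} = {0} ∪ LieKoszul.eigenCharacters ρ := by
  open LieKoszul in
  have heig : ∀ (f : Module.Dual ℂ L) (x : X), (∀ l, ρ l x = f l • x) →
      ∀ a, twist (ρ : L →ₗ[ℂ] X →L[ℂ] X) f a x = 0 := fun f x h a => by
    rw [twist_apply, h a, sub_self]
  have hker0 : ∀ θ : L →ₗ[ℂ] X →L[ℂ] X, LinearMap.ker (diff θ 0) = ⊤ :=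
    fun θ => LinearMap.ker_zero
  have hscalar : ∀ (f : Module.Dual ℂ L) (l : L),
      twist (ρ : L →ₗ[ℂ] X →L[ℂ] X) f l = ρ l - f l • 1 := fun f l => rfl
  -- At `f = 0` compactness in infinite dimension suffices; the eigenvectors play no role.
  have hzero : (0 : Module.Dual ℂ L) ∈ sigma ρ 0 := by
    refine (mem_sigma_iff ρ 0 0).mpr ⟨fun _ _ => rfl, ?_⟩
    rw [hker0, top_le_iff]
    refine range_diff_one_ne_top_of_compact hX fun l => ?_
    rw [hscalar, LinearMap.zero_apply, zero_smul, sub_zero]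
    exact hρ l
  have hbot : ∀ f ∈ eigenCharacters ρ, f ≠ 0 → f ∈ sigma ρ 0 := by
    rintro f ⟨hf, x, hx0, hx⟩ hf0
    obtain ⟨l, hl⟩ : ∃ l, f l ≠ 0 := by
      by_contra! h
      exact hf0 (LinearMap.ext h)
    refine (mem_sigma_iff ρ 0 f).mpr ⟨hf, ?_⟩
    rw [hker0, top_le_iff]
    exact range_diff_one_ne_top_of_invariant (isRep_twist ρ hf) (hρ l) hl (hscalar f l) hx0
      (heig f x hx)
  have htop : ∀ f ∈ eigenCharacters ρ, f ∈ sigma ρ (Module.finrank ℂ L) := by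
    rintro f ⟨hf, x, hx0, hx⟩
    obtain ⟨z, hz, hz'⟩ := exists_top_cycle (twist (ρ : L →ₗ[ℂ] X →L[ℂ] X) f) hx0 (heig f x hx) rfl
    exact (mem_sigma_iff ρ _ f).mpr ⟨hf, fun h => hz' (h hz)⟩
  have hexact : ∀ f, IsCharacter f → f ≠ 0 → f ∉ eigenCharacters ρ → ∀ p,
      LinearMap.ker (diff (twist (ρ : L →ₗ[ℂ] X →L[ℂ] X) f) p) ≤
        LinearMap.range (diff (twist (ρ : L →ₗ[ℂ] X →L[ℂ] X) f) (p + 1)) := by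
    intro f hf hf0 hne p
    obtain ⟨l, hl⟩ : ∃ l, f l ≠ 0 := by
      by_contra! h
      exact hf0 (LinearMap.ext h)
    refine ker_diff_le_range_diff (isRep_twist ρ hf) (hρ l) hl (hscalar f l) (fun x hx => ?_) p
    by_contra hx0
    exact hne ⟨hf, x, hx0, fun a => sub_eq_zero.mp (hx a)⟩
  have hsigma : ∀ p, ∀ f ∈ sigma ρ p, f ≠ 0 → f ∈ eigenCharacters ρ := by
    intro p f hfp hf0
    obtain ⟨hf, hne⟩ := (mem_sigma_iff ρ p f).mp hfp
    by_contra h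
    exact hne (hexact f hf hf0 h p)
  have hclosed : ∀ f, IsCharacter f → f ≠ 0 → f ∉ eigenCharacters ρ → ∀ p,
      IsClosed[tensorTopology X (⋀[ℂ]^(p - 1) L)]
        (LinearMap.range (diff (twist (ρ : L →ₗ[ℂ] X →L[ℂ] X) f) p) :
          Set (X ⊗[ℂ] ⋀[ℂ]^(p - 1) L)) := by
    intro f hf hf0 hne p
    cases p with
    | zero =>
      rw [show LinearMap.range (diff (twist (ρ : L →ₗ[ℂ] X →L[ℂ] X) f) 0) =
        LinearMap.ker LinearMap.id from LinearMap.range_zero.trans LinearMap.ker_id.symm]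
      refine isClosed_ker_of_continuous _ fun φ v => ?_
      simp only [LinearMap.id_apply, contract_tmul]
      fun_prop
    | succ p =>
      have h : LinearMap.range (diff (twist (ρ : L →ₗ[ℂ] X →L[ℂ] X) f) (p + 1)) =
          LinearMap.ker (diff (twist (ρ : L →ₗ[ℂ] X →L[ℂ] X) f) p) := by
        refine le_antisymm ?_ (hexact f hf hf0 hne p)
        rintro _ ⟨z, rfl⟩
        cases p with
        | zero => rfl
        | succ p => exact diff_diff (isRep_twist ρ hf) p z
      rw [h]
      exact isClosed_ker_diff _ p
  refine ⟨?_, fun k hk => ⟨?_, ?_⟩⟩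
  · ext f
    simp only [taylorSpectrum, Set.mem_iUnion, Set.mem_union, Set.mem_singleton_iff, Set.mem_Icc]
    by_cases hf0 : f = 0
    · subst hf0
      simp only [true_or, iff_true]
      exact ⟨0, by simp, hzero⟩
    · simp only [hf0, false_or]
      exact ⟨fun ⟨p, _, hp⟩ => hsigma p f hp hf0, fun h => ⟨0, by simp, hbot f h hf0⟩⟩
  · ext f
    simp only [deltaSpectrum, Set.mem_iUnion, Set.mem_union, Set.mem_singleton_iff, Set.mem_Icc]
    by_cases hf0 : f = 0
    · simp [hf0]
    · simp only [hf0, false_or, or_false]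
      exact ⟨fun ⟨p, _, hp⟩ => hsigma p f hp hf0, fun h => ⟨0, by simp, hbot f h hf0⟩⟩
  · ext f
    simp only [piSpectrum, Set.mem_iUnion, Set.mem_union, Set.mem_singleton_iff, Set.mem_Icc,
      Set.mem_ofPred_eq]
    by_cases hf0 : f = 0
    · simp [hf0]
    · simp only [hf0, false_or, or_false]
      refine ⟨?_, fun h => Or.inl ⟨_, ⟨Nat.sub_le _ _, le_rfl⟩, htop f h⟩⟩
      rintro (⟨p, _, hp⟩ | ⟨hf, hncl⟩)
      · exact hsigma p f hp hf0
      · by_contra h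
        exact hncl (hclosed f hf hf0 h _)
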